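/- Let $R$ be a Noetherian commutative ring of Krull dimension $\le 4$, let $P_0$ be a finitely generated projective $R$-module of constant rank $2$, and let $\theta_0 : R \xrightarrow{\cong} \det(P_0)=\bigwedge^2 P_0$ be a trivialization of its determinant. Let $\chi_0$ be the non-degenerate alternating form $\chi_0(p,q)=\theta_0^{-1}(p\wedge q)$ on $P_0$, and for $n\ge 3$ let $P_n = P_0\oplus Re_3\oplus\dots\oplus Re_n$ with $Re_i$ free of rank $1$ on the generator $e_i$. For a finitely generated projective $R$-module $P$, let $Um(P)$ be the set of epimorphisms $P\to R$ and $SL(P)$ the group of automorphisms of $P$ of determinant $1$, acting on the right on $Um(P)$ by precomposition. For a bilinear form $\chi$ on $P$, let $Sp(\chi)$ be the group of automorphisms $\varphi$ of $P$ with $\chi(\varphi x,\varphi y)=\chi(x,y)$ for all $x,y\in P$. Let $\psi_2=\begin{pmatrix}0&1\\-1&0\end{pmatrix}$ and $\psi_{2n+2}=\psi_{2n}\perp\psi_2$, and let $\chi_0\perp\psi_2$ denote the form on $P_4=P_0\oplus(Re_3\oplus Re_4)$ that is $\chi_0$ on $P_0$ and has matrix $\psi_2$ on $Re_3\oplus Re_4$.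 Let $W'_{SL}(R)$ be the set of equivalence classes of alternating invertible matrices over $R$ of even size, where matrices $M$ of size $2m$ and $N$ of size $2n$ are equivalent if $M\perp\psi_{2n+2s}=E^{t}(N\perp\psi_{2m+2s})E$ for some $s\in\mathbb N$ and some $E\in SL_{2m+2n+2s}(R)$; it is an abelian group under $\perp$ whose neutral element is the class of the matrices $\psi_{2n}$. Let $W_{SL}(R)$ be the kernel of the homomorphism $W'_{SL}(R)\to R^\times$ induced by the Pfaffian. Suppose that $SL(P_5)$ acts transitively on $Um(P_5)$. Then the orbit space $Um(P_0\oplus R)/SL(P_0\oplus R)$ is trivial (i.e. consists of a single orbit) if and only if $W_{SL}(R)=0$ and $$SL(P_4)\,e_4 = Sp(\chi_0\perp\psi_2)\,e_4,$$ where $G e_4=\{\varphi(e_4) : \varphi\in G\}$. -/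

import Mathlib

namespace RankTwo

section Modules

variable (R : Type*) [CommRing R] (P : Type*) [AddCommGroup P] [Module R P]

/-- `Um(P)`: the set of epimorphisms `P → R`. -/
def Um : Set (P →ₗ[R] R) := {a | Function.Surjective a}

variable {R P}

/-- The determinant of `φ ⊕ id_Q` on `P ⊕ Q ≅ Rⁿ`, where the direct sum decomposition is given by an
inclusion `g : P → Rⁿ` and a retraction `f : Rⁿ → P` of it, with `Q = ker f`: the endomorphism
`φ ⊕ id_Q` is `g φ f + (1 - g f) = 1 + g (φ - 1) f`. -/
noncomputable def complDet {n : ℕ} (f : (Fin n → R) →ₗ[R] P) (g : P →ₗ[R] (Fin n → R))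
    (φ : Module.End R P) : R :=
  LinearMap.det (1 + g ∘ₗ (φ - 1) ∘ₗ f : Module.End R (Fin n → R))

/-- `complDet` does not depend on the choice of the complement. -/
theorem complDet_eq_complDet {m n : ℕ} (f : (Fin n → R) →ₗ[R] P) (g : P →ₗ[R] (Fin n → R))
    (f' : (Fin m → R) →ₗ[R] P) (g' : P →ₗ[R] (Fin m → R))
    (h : f ∘ₗ g = LinearMap.id) (h' : f' ∘ₗ g' = LinearMap.id) (φ : Module.End R P) :
    complDet f g φ = complDet f' g' φ := by
  have e1 : g ∘ₗ (φ - 1) ∘ₗ f = (g ∘ₗ (φ - 1) ∘ₗ f') ∘ₗ (g' ∘ₗ f) := by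
    ext1 i
    ext1
    have := LinearMap.congr_fun h' (f (Pi.single i 1))
    simp only [LinearMap.comp_apply, LinearMap.id_apply] at this
    simp [this]
  have e2 : g' ∘ₗ (φ - 1) ∘ₗ f' = (g' ∘ₗ f) ∘ₗ (g ∘ₗ (φ - 1) ∘ₗ f') := by
    ext1 i
    ext1
    have := fun x => LinearMap.congr_fun h x
    simp only [LinearMap.comp_apply, LinearMap.id_apply] at this
    simp [this]
  rw [complDet, complDet, e1, e2, ← LinearMap.det_toMatrix', ← LinearMap.det_toMatrix', map_add,
    map_add, LinearMap.toMatrix'_one, LinearMap.toMatrix'_one, LinearMap.toMatrix'_comp,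
    LinearMap.toMatrix'_comp _ (g ∘ₗ _), Matrix.det_one_add_mul_comm]

theorem complDet_mul {n : ℕ} (f : (Fin n → R) →ₗ[R] P) (g : P →ₗ[R] (Fin n → R))
    (h : f ∘ₗ g = LinearMap.id) (φ ψ : Module.End R P) :
    complDet f g (φ * ψ) = complDet f g φ * complDet f g ψ := by
  rw [complDet, complDet, complDet, ← map_mul]
  congr 1
  have h0 := fun x => LinearMap.congr_fun h x
  simp only [LinearMap.comp_apply, LinearMap.id_apply] at h0
  ext1 i
  ext1
  simp [h0]
  abel

variable [Module.Finite R P] [Module.Projective R P]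

/-- The determinant of an endomorphism `φ` of a finitely generated projective module `P`: the
determinant of `φ ⊕ id_Q` on the free module `P ⊕ Q`, for any `Q` with `P ⊕ Q` free of finite rank.
(Mathlib's `LinearMap.det` is `1` on modules without a basis.) -/
noncomputable def projDet (φ : Module.End R P) : R :=
  complDet (Module.Finite.exists_comp_eq_id_of_projective R P).choose_spec.choose
    (Module.Finite.exists_comp_eq_id_of_projective R P).choose_spec.choose_spec.choose φ

theorem projDet_eq_complDet {n : ℕ} (f : (Fin n → R) →ₗ[R] P) (g : P →ₗ[R] (Fin n → R))
    (h : f ∘ₗ g = LinearMap.id) (φ : Module.End R P) : projDet φ = complDet f g φ :=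
  complDet_eq_complDet _ _ _ _
    (Module.Finite.exists_comp_eq_id_of_projective
      R P).choose_spec.choose_spec.choose_spec.2.2 h φ

theorem projDet_mul (φ ψ : Module.End R P) : projDet (φ * ψ) = projDet φ * projDet ψ :=
  complDet_mul _ _ (Module.Finite.exists_comp_eq_id_of_projective
      R P).choose_spec.choose_spec.choose_spec.2.2 φ ψ

theorem projDet_one : projDet (1 : Module.End R P) = 1 := by
  simp [projDet, complDet]

variable (R P)

/-- `SL(P)`: the group of automorphisms of `P` of determinant `1`. -/
def SL : Subgroup (P ≃ₗ[R] P) where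
  carrier := {φ | projDet (φ : Module.End R P) = 1}
  mul_mem' {φ ψ} hφ hψ := by
    have h := projDet_mul (φ : Module.End R P) (ψ : Module.End R P)
    rw [hφ, hψ, one_mul] at h
    exact h
  one_mem' := projDet_one
  inv_mem' {φ} hφ := by
    have h := projDet_mul (φ : Module.End R P) ((φ⁻¹ : P ≃ₗ[R] P) : Module.End R P)
    have e : (φ : Module.End R P) * ((φ⁻¹ : P ≃ₗ[R] P) : Module.End R P) = 1 := by
      ext x
      exact LinearEquiv.apply_symm_apply φ x
    rw [hφ, one_mul, e, projDet_one] at h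
    exact h.symm

/-- Two elements of `Um(P)` lie in the same orbit of the right action of `SL(P)` by
precomposition. -/
def umSetoid : Setoid (Um R P) where
  r a b := ∃ φ ∈ SL R P, a.1 ∘ₗ (φ : P →ₗ[R] P) = b.1
  iseqv :=
    { refl := fun a => ⟨1, one_mem _, rfl⟩
      symm := by
        rintro a b ⟨φ, hφ, h⟩
        refine ⟨φ⁻¹, inv_mem hφ, ?_⟩
        rw [← h]
        ext x
        exact congrArg a.1 (LinearEquiv.apply_symm_apply φ x)
      trans := by
        rintro a b c ⟨φ, hφ, h⟩ ⟨ψ, hψ, h'⟩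
        refine ⟨φ * ψ, mul_mem hφ hψ, ?_⟩
        rw [← h', ← h]
        rfl }

/-- The orbit space `Um(P)/SL(P)`. -/
def UmModSL : Type _ := Quotient (umSetoid R P)

end Modules

section Matrices

variable {R : Type*} [CommRing R]

/-- `ψ_{2n}`, the block diagonal matrix with `n` blocks `!![0, 1; -1, 0]`. -/
def psi (R : Type*) [CommRing R] (n : ℕ) : Matrix (Fin (2 * n)) (Fin (2 * n)) R :=
  Matrix.of fun i j =>
    if i.1 % 2 = 0 ∧ j.1 = i.1 + 1 then 1 else if j.1 % 2 = 0 ∧ i.1 = j.1 + 1 then -1 else 0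

/-- The orthogonal sum `M ⊥ N`, i.e. the block diagonal matrix with blocks `M` and `N`. -/
def perp {m n : ℕ} (M : Matrix (Fin (2 * m)) (Fin (2 * m)) R)
    (N : Matrix (Fin (2 * n)) (Fin (2 * n)) R) :
    Matrix (Fin (2 * (m + n))) (Fin (2 * (m + n))) R :=
  Matrix.reindex (finSumFinEquiv.trans (finCongr (Nat.mul_add 2 m n).symm))
    (finSumFinEquiv.trans (finCongr (Nat.mul_add 2 m n).symm)) (Matrix.fromBlocks M 0 0 N)

/-- The Pfaffian, defined by expansion along the first row. -/
def pf : (n : ℕ) → Matrix (Fin (2 * n)) (Fin (2 * n)) R → R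
  | 0, _ => 1
  | n + 1, M => ∑ j : Fin (2 * n + 1), (-1) ^ j.1 * M 0 j.succ *
      pf n (M.submatrix (fun i => (j.succAbove i).succ) (fun i => (j.succAbove i).succ))

/-- `A_{2n}(R)`: the set of alternating invertible matrices of size `2n`. -/
def A (R : Type*) [CommRing R] (n : ℕ) : Set (Matrix (Fin (2 * n)) (Fin (2 * n)) R) :=
  {M | M.transpose = -M ∧ (∀ i, M i i = 0) ∧ IsUnit M}

/-- `SL`-equivalence: `M ∈ A_{2m}(R)` and `N ∈ A_{2n}(R)` are equivalent if
`M ⊥ ψ_{2n+2s} = Eᵗ (N ⊥ ψ_{2m+2s}) E` for some `s` and some `E ∈ SL_{2m+2n+2s}(R)`. -/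
def SLEquiv (x y : Σ n, A R n) : Prop :=
  ∃ (s : ℕ) (E : Matrix.SpecialLinearGroup (Fin (2 * (x.1 + (y.1 + s)))) R),
    perp x.2.1 (psi R (y.1 + s)) =
      E.1.transpose *
        Matrix.reindex (finCongr (congrArg (2 * ·) (Nat.add_left_comm y.1 x.1 s)))
          (finCongr (congrArg (2 * ·) (Nat.add_left_comm y.1 x.1 s)))
          (perp y.2.1 (psi R (x.1 + s))) * E.1

/-- `W'_SL(R)`: alternating invertible matrices of any even size, up to `SL`-equivalence.
(A matrix `M` is `SL`-equivalent to its stabilizations `M ⊥ ψ_{2k}`, so that it does not matter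
whether one passes to the direct limit of the `A_{2n}(R)` first.) -/
def WSL' (R : Type*) [CommRing R] : Type _ := Quot (SLEquiv (R := R))

/-- The class in `W'_SL(R)` of an alternating invertible matrix. -/
def WSL'.mk {n : ℕ} (M : A R n) : WSL' R := Quot.mk _ ⟨n, M⟩

/-- The neutral element of `W'_SL(R)`: the class of the empty matrix `ψ_0`, which is also the class
of each `ψ_{2n}`. -/
def WSL'.zero (R : Type*) [CommRing R] : WSL' R :=
  WSL'.mk (n := 0) ⟨psi R 0, by ext i; exact i.elim0, fun i => i.elim0, by
    rw [show psi R 0 = 1 by ext i; exact i.elim0]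
    exact isUnit_one⟩

/-- `W_SL(R)`: the kernel of the Pfaffian `W'_SL(R) → Rˣ`, i.e. the set of classes of matrices of
Pfaffian `1`. -/
def WSL (R : Type*) [CommRing R] : Set (WSL' R) :=
  {w | ∃ (n : ℕ) (M : A R n), WSL'.mk M = w ∧ pf n M.1 = 1}

end Matrices

section Forms

variable {R : Type*} [CommRing R]

/-- The alternating form `χ₀(p, q) = θ₀⁻¹(p ∧ q)` on a module `P₀` of rank `2` with a trivialization
`θ₀ : R ≅ det(P₀) = ⋀² P₀` of its determinant. -/
noncomputable def chi₀ {P₀ : Type*} [AddCommGroup P₀] [Module R P₀] (θ₀ : R ≃ₗ[R] ⋀[R]^2 P₀) :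
    LinearMap.BilinForm R P₀ :=
  LinearMap.mk₂ R (fun p q => θ₀.symm (exteriorPower.ιMulti R 2 ![p, q]))
    (fun p p' q => by
      rw [← map_add]
      exact congrArg _ ((exteriorPower.ιMulti R 2).map_vecCons_add ![q] p p'))
    (fun c p q => by
      rw [← map_smul]
      exact congrArg _ ((exteriorPower.ιMulti R 2).map_vecCons_smul ![q] c p))
    (fun p q q' => by
      have e : ∀ r s : P₀, Function.update ![p, r] 1 s = ![p, s] := fun r s => by
        ext i; fin_cases i <;> rfl
      have h := (exteriorPower.ιMulti R 2 (M := P₀)).map_update_add ![p, q] 1 q q'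
      rw [e, e, e] at h
      rw [← map_add, h])
    (fun c p q => by
      have e : ∀ r s : P₀, Function.update ![p, r] 1 s = ![p, s] := fun r s => by
        ext i; fin_cases i <;> rfl
      have h := (exteriorPower.ιMulti R 2 (M := P₀)).map_update_smul ![p, q] 1 c q
      rw [e, e] at h
      rw [← map_smul, h])

/-- The orthogonal sum `χ ⊥ χ'` of bilinear forms on `P` and `Q`, a form on `P ⊕ Q`. -/
def formPerp {P Q : Type*} [AddCommGroup P] [Module R P] [AddCommGroup Q] [Module R Q]
    (χ : LinearMap.BilinForm R P) (χ' : LinearMap.BilinForm R Q) : LinearMap.BilinForm R (P × Q) :=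
  χ.compl₁₂ (LinearMap.fst R P Q) (LinearMap.fst R P Q) +
    χ'.compl₁₂ (LinearMap.snd R P Q) (LinearMap.snd R P Q)

/-- `Sp(χ)`: the group of automorphisms `φ` of `P` with `φᵗ χ φ = χ`. -/
def Sp {P : Type*} [AddCommGroup P] [Module R P] (χ : LinearMap.BilinForm R P) :
    Subgroup (P ≃ₗ[R] P) where
  carrier := {φ | ∀ x y, χ (φ x) (φ y) = χ x y}
  mul_mem' {φ ψ} hφ hψ x y := (hφ (ψ x) (ψ y)).trans (hψ x y)
  one_mem' _ _ := rfl
  inv_mem' {φ} hφ x y := by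
    have h := hφ (φ⁻¹ x) (φ⁻¹ y)
    have e : ∀ z, φ (φ⁻¹ z) = z := fun z => LinearEquiv.apply_symm_apply φ z
    rw [e, e] at h
    exact h.symm

/-- The form `ψ_{2n}` on `R^{2n}`, `(u, v) ↦ uᵗ ψ_{2n} v`. -/
def psiForm (R : Type*) [CommRing R] (n : ℕ) : LinearMap.BilinForm R (Fin (2 * n) → R) :=
  Matrix.toLinearMap₂' R (psi R n)

end Forms

/-- `P_n = P₀ ⊕ R e₃ ⊕ ⋯ ⊕ R e_n` for `n ≥ 2`: the generator `e_{i+3}` is the `i`-th standard basis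
vector of the second summand. -/
abbrev Pn (R P₀ : Type*) (n : ℕ) : Type _ := P₀ × (Fin (n - 2) → R)

/-- The generator `e₄` of `P₄ = P₀ ⊕ R e₃ ⊕ R e₄`. -/
def e₄ (R P₀ : Type*) [CommRing R] [AddCommGroup P₀] : Pn R P₀ 4 := (0, ![0, 1])

end RankTwo

/-! Write `χ` for the form `χ₀`. It is perfect, satisfies the Plücker relation, and its values
generate the unit ideal. Hence `(P₀, χ)` is an orthogonal summand of some `(R²ᵐ, ψ_{2m})`, and
alternating forms on `P₀ ⊕ R²ⁿ` can be compared with alternating matrices: `ω ⊥ ψ_{2m} ≅ χ ⊥ ω̂`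
with `ω̂` on a free module (`isometric_formPerp_hat`). The Pfaffian of `ω̂` is a relative Pfaffian
of `ω`. It is multiplied by the determinant under pullback (`relPf_comp`) and equals `u` on `uχ ⊥
ψ_{2n}`. In particular isometries between forms of relative Pfaffian `1` and `χ ⊥ ψ_{2n}` have
determinant `1`.

Suppose the orbit space is trivial. Then `SL` acts transitively on `Um(P₀ ⊕ R²ⁿ ⊕ R)` for every `n`:
this is the assumption for `n = 0`, the hypothesis on `P₅` for `n = 1`, and Bass' stable range
theorem for `n ≥ 2`. Splitting off hyperbolic planes (`UmTransitive.exists_hyp`) brings every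
perfect alternating form on `P₀ ⊕ R²ⁿ` to `uχ ⊥ ψ_{2n}` by an element of `SL`, where `u` is the
relative Pfaffian. For `χ ⊥ M` with `M` of Pfaffian `1` this shows that `M` is stably trivial. For
the pullback of `χ ⊥ ψ₂` by some `φ ∈ SL(P₄)` it gives `ρ` fixing `e₄` with `φρ` symplectic, so `φ
e₄` lies in the symplectic orbit.

Conversely, let `a ∈ Um(P₀ ⊕ R)`. Vaserstein's construction gives a form `ω` on `P₄` of relative
Pfaffian `1` with `ω(·, e₄) = a` (`exists_vasersteinForm`). Since `W_SL(R) = 0`, `ω` is stably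
isometric to `χ ⊥ ψ₂`, and in dimension at most `4` hyperbolic planes cancel, so some `φ ∈ SL(P₄)`
carries `ω` to `χ ⊥ ψ₂`. The orbit condition allows correcting `φ` by a symplectic automorphism so
that it fixes `e₄`. It then induces an automorphism of `P₄/Re₄ = P₀ ⊕ R` of determinant `1` whose
last coordinate is `a`. -/

namespace RankTwo

/-! ### The Pfaffian as an alternating function of vectors -/

section Pfaffian

variable {R : Type*} [CommRing R] {V : Type*} [AddCommGroup V] [Module R V]

/-- The Gram matrix of a family of vectors. -/
def gram {ι : Type*} (B : LinearMap.BilinForm R V) (v : ι → V) : Matrix ι ι R :=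
  Matrix.of fun i j => B (v i) (v j)

theorem pf_succ (n : ℕ) (M : Matrix (Fin (2 * (n + 1))) (Fin (2 * (n + 1))) R) :
    pf (n + 1) M = ∑ j : Fin (2 * n + 1), (-1) ^ j.1 * M 0 j.succ *
      pf n (M.submatrix (fun i => (j.succAbove i).succ) (fun i => (j.succAbove i).succ)) := rfl

/-- The alternating map `w ↦ ∑ j, ± B(x, w_j) F(w without w_j)`, linear in `x`. -/
def contractWedge {k : ℕ} (B : LinearMap.BilinForm R V) (F : V [⋀^Fin k]→ₗ[R] R) :
    V →ₗ[R] V [⋀^Fin (k + 1)]→ₗ[R] R where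
  toFun x := AlternatingMap.alternatizeUncurryFin ((B x).smulRight F)
  map_add' x y := by
    ext w
    simp [AlternatingMap.alternatizeUncurryFin_apply, add_mul, Finset.sum_add_distrib]
  map_smul' c x := by
    ext w
    simp only [AlternatingMap.alternatizeUncurryFin_apply, Finset.smul_sum, RingHom.id_apply,
      AlternatingMap.smul_apply, LinearMap.smulRight_apply, map_smul, LinearMap.smul_apply]
    refine Finset.sum_congr rfl fun i _ => ?_
    rw [smul_comm c, smul_assoc]

theorem contractWedge_apply {k : ℕ} (B : LinearMap.BilinForm R V) (F : V [⋀^Fin k]→ₗ[R] R) (x : V)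
    (w : Fin (k + 1) → V) :
    contractWedge B F x w = ∑ j, (-1) ^ j.1 * B x (w j) * F (j.removeNth w) := by
  simp only [contractWedge, LinearMap.coe_mk, AddHom.coe_mk,
    AlternatingMap.alternatizeUncurryFin_apply, LinearMap.smulRight_apply,
    AlternatingMap.smul_apply, smul_eq_mul, mul_assoc]
  refine Finset.sum_congr rfl fun i _ => ?_
  rcases Nat.even_or_odd i.1 with h | h <;> simp [h.neg_one_pow]

/-- Wedging twice with the same functional `B x` gives zero: it is the double alternatization of a
map symmetric in its two arguments. -/
theorem contractWedge_contractWedge {k : ℕ} (B : LinearMap.BilinForm R V)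
    (F : V [⋀^Fin k]→ₗ[R] R) (x : V) : contractWedge B (contractWedge B F x) x = 0 := by
  let f : V →ₗ[R] V →ₗ[R] V [⋀^Fin k]→ₗ[R] R :=
    (B x).smulRight ((B x).smulRight F)
  have h := AlternatingMap.alternatizeUncurryFin_alternatizeUncurryFinLM_comp_of_symmetric
    (f := f) (fun y z => by simp [f, smul_smul, mul_comm])
  rw [← h]
  simp only [contractWedge, LinearMap.coe_mk, AddHom.coe_mk]
  congr 1
  ext y w
  simp [f]

/-- The Pfaffian of the Gram matrix is an alternating function of the vectors. -/
theorem exists_pf_gram (B : LinearMap.BilinForm R V) (hB : ∀ x, B x x = 0) (n : ℕ) :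
    ∃ F : V [⋀^Fin (2 * n)]→ₗ[R] R, (∀ v, F v = pf n (gram B v)) ∧
      ∀ x w, contractWedge B F x (Fin.cons x w) = 0 := by
  induction n with
  | zero =>
    have : IsEmpty (Fin (2 * 0)) := Fin.isEmpty'
    refine ⟨AlternatingMap.constOfIsEmpty R V (Fin (2 * 0)) 1, fun v => rfl, fun x w => ?_⟩
    rw [contractWedge_apply]
    refine Finset.sum_eq_zero fun j _ => ?_
    have : j = 0 := Fin.ext (by omega)
    subst this
    simp [hB]
  | succ n ih =>
    obtain ⟨F, hF, hF'⟩ := ih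
    -- `G` is expansion along the first row. Vanishing on a repetition of the first vector among the
    -- others is not formal; it is the second clause of the induction hypothesis, carried along for
    -- this purpose.
    let G : V [⋀^Fin (2 * n + 1 + 1)]→ₗ[R] R :=
      { LinearMap.uncurryLeft (AlternatingMap.toMultilinearMapLM (S := R) ∘ₗ
          contractWedge B F) with
        map_eq_zero_of_eq' := by
          have key : ∀ (v : Fin (2 * n + 1 + 1) → V) (j : Fin (2 * n + 1)), v 0 = v j.succ →
              contractWedge B F (v 0) (Fin.tail v) = 0 := by
            intro v j h
            have e : Fin.tail v = j.insertNth (v 0) (j.removeNth (Fin.tail v)) := by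
              rw [h]
              exact (Fin.insertNth_self_removeNth j (Fin.tail v)).symm
            rw [e, AlternatingMap.map_insertNth]
            erw [hF']
            simp
          intro v i j h hij
          change contractWedge B F (v 0) (Fin.tail v) = 0
          rcases Fin.eq_zero_or_eq_succ i with rfl | ⟨i, rfl⟩
          · rcases Fin.eq_zero_or_eq_succ j with rfl | ⟨j, rfl⟩
            · exact absurd rfl hij
            · exact key v j h
          · rcases Fin.eq_zero_or_eq_succ j with rfl | ⟨j, rfl⟩
            · exact key v i h.symm
            · exact (contractWedge B F (v 0)).map_eq_zero_of_eq _ (i := i) (j := j) h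
                fun h' => hij (congrArg _ h') }
    have hG : ∀ v, G v = contractWedge B F (v 0) (Fin.tail v) := fun v => rfl
    refine ⟨G, fun v => ?_, fun x w => ?_⟩
    · rw [hG, pf_succ, contractWedge_apply]
      refine Finset.sum_congr rfl fun j _ => ?_
      rw [hF]
      rfl
    · rw [contractWedge_apply, Fin.sum_univ_succ]
      simp only [Fin.cons_zero, hB, mul_zero, zero_mul, zero_add, Fin.cons_succ]
      have e : ∀ i : Fin (2 * n + 1 + 1), G (i.succ.removeNth (Fin.cons x w : Fin _ → V)) =
          contractWedge B F x (i.removeNth w) := by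
        intro i
        rw [hG]
        congr 1
        ext l
        simp [Fin.tail, Fin.removeNth]
      have h := congrArg (fun f : V [⋀^Fin (2 * n + 1 + 1)]→ₗ[R] R => f w)
        (contractWedge_contractWedge B F x)
      simp only [contractWedge_apply B (contractWedge B F x), AlternatingMap.zero_apply] at h
      rw [← neg_eq_zero, ← h, ← Finset.sum_neg_distrib]
      refine Finset.sum_congr rfl fun i _ => ?_
      erw [e]
      rw [Fin.val_succ, pow_succ]
      ring

/-- On a free module, an alternating map of top degree is a multiple of the determinant. -/
theorem pf_gram_eq_det_mul (B : LinearMap.BilinForm R V) (hB : ∀ x, B x x = 0) {n : ℕ}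
    (b : Module.Basis (Fin (2 * n)) R V) (v : Fin (2 * n) → V) :
    pf n (gram B v) = b.det v * pf n (gram B b) := by
  obtain ⟨F, hF, -⟩ := exists_pf_gram B hB n
  rw [← hF, ← hF]
  conv_lhs => rw [F.eq_smul_basis_det b]
  simp [mul_comm]

theorem pf_gram_comp (B : LinearMap.BilinForm R V) (hB : ∀ x, B x x = 0) {n : ℕ}
    (b : Module.Basis (Fin (2 * n)) R V) (φ : V →ₗ[R] V) :
    pf n (gram B (φ ∘ b)) = LinearMap.det φ * pf n (gram B b) := by
  rw [pf_gram_eq_det_mul B hB b, b.det_comp, b.det_self, mul_one]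

theorem pf_map {S : Type*} [CommRing S] (f : R →+* S) (n : ℕ)
    (M : Matrix (Fin (2 * n)) (Fin (2 * n)) R) : pf n (M.map f) = f (pf n M) := by
  induction n with
  | zero => simp [pf]
  | succ n ih =>
    rw [pf_succ, pf_succ, map_sum]
    refine Finset.sum_congr rfl fun j _ => ?_
    rw [map_mul, map_mul, ← ih]
    simp [Matrix.submatrix_map]

/-- The Pfaffian depends linearly on the first row. -/
theorem pf_row_zero {n : ℕ} (X Y Z : Matrix (Fin (2 * (n + 1))) (Fin (2 * (n + 1))) R) (a b : R)
    (hX : ∀ i j, i ≠ 0 → j ≠ 0 → X i j = Z i j) (hY : ∀ i j, i ≠ 0 → j ≠ 0 → Y i j = Z i j)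
    (h : ∀ j, Z 0 j = a * X 0 j + b * Y 0 j) :
    pf (n + 1) Z = a * pf (n + 1) X + b * pf (n + 1) Y := by
  simp only [pf_succ, Finset.mul_sum, ← Finset.sum_add_distrib]
  refine Finset.sum_congr rfl fun j _ => ?_
  have e : ∀ W : Matrix (Fin (2 * (n + 1))) (Fin (2 * (n + 1))) R,
      (∀ i j, i ≠ 0 → j ≠ 0 → W i j = Z i j) →
      W.submatrix (fun i => (j.succAbove i).succ) (fun i => (j.succAbove i).succ) =
        Z.submatrix (fun i => (j.succAbove i).succ) (fun i => (j.succAbove i).succ) := by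
    intro W hW
    ext i k
    exact hW _ _ (Fin.succ_ne_zero _) (Fin.succ_ne_zero _)
  rw [e X hX, e Y hY, h]
  ring

/-- Only entries above the diagonal enter the recursive definition, so nothing is required of the
lower left block. The size `k` is kept separate from `m + n` so that the induction needs no casts.
-/
theorem pf_block {m n k : ℕ} (M : Matrix (Fin (2 * m)) (Fin (2 * m)) R)
    (N : Matrix (Fin (2 * n)) (Fin (2 * n)) R) (X : Matrix (Fin (2 * k)) (Fin (2 * k)) R)
    (hk : k = m + n)
    (h11 : ∀ (i j : Fin (2 * k)) (hi : i.1 < 2 * m) (hj : j.1 < 2 * m),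
      X i j = M ⟨i, hi⟩ ⟨j, hj⟩)
    (h12 : ∀ i j : Fin (2 * k), i.1 < 2 * m → 2 * m ≤ j.1 → X i j = 0)
    (h22 : ∀ (i j : Fin (2 * n)) (hi : i.1 + 2 * m < 2 * k) (hj : j.1 + 2 * m < 2 * k),
      X ⟨i.1 + 2 * m, hi⟩ ⟨j.1 + 2 * m, hj⟩ = N i j) :
    pf k X = pf m M * pf n N := by
  induction m generalizing k with
  | zero =>
    obtain rfl : k = n := by omega
    have : X = N := by
      ext i j
      exact h22 i j i.2 j.2
    simp [this, pf]
  | succ m ih =>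
    obtain ⟨k, rfl⟩ : ∃ l, k = l + 1 := ⟨m + n, by omega⟩
    have hk' : k = m + n := by omega
    rw [pf_succ, pf_succ, Finset.sum_mul]
    have hle : 2 * m + 1 ≤ 2 * k + 1 := by omega
    symm
    refine Finset.sum_of_injOn (Fin.castLE hle) (fun i _ j _ h => Fin.castLE_injective hle h)
      (fun i _ => Finset.mem_coe.2 (Finset.mem_univ _)) ?_ ?_
    · intro j _ hj
      have : 2 * m + 1 ≤ j.1 := by
        by_contra hlt
        exact hj ⟨⟨j.1, by omega⟩, by simp, Fin.ext rfl⟩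
      rw [h12 0 j.succ (by simp) (by simp; omega)]
      ring
    · intro j _
      rw [ih (k := k) (M.submatrix (fun i => (j.succAbove i).succ) (fun i => (j.succAbove i).succ))
        (X.submatrix (fun i => ((Fin.castLE hle j).succAbove i).succ)
          (fun i => ((Fin.castLE hle j).succAbove i).succ)) hk' ?_ ?_ ?_]
      · rw [h11 0 (Fin.castLE hle j).succ (by simp) (by simp; omega)]
        simp only [Fin.val_castLE]
        rw [mul_assoc]
        rfl
      · intro i i' hi hi'
        simp only [Matrix.submatrix_apply]
        rw [h11 _ _ (by simp [Fin.succAbove, Fin.lt_def]; split_ifs <;> simp <;> omega)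
          (by simp [Fin.succAbove, Fin.lt_def]; split_ifs <;> simp <;> omega)]
        congr 1 <;> (apply Fin.ext; simp [Fin.succAbove, Fin.lt_def]; split_ifs <;> simp)
      · intro i i' hi hi'
        simp only [Matrix.submatrix_apply]
        apply h12
        · simp [Fin.succAbove, Fin.lt_def]; split_ifs <;> simp <;> omega
        · simp [Fin.succAbove, Fin.lt_def]; split_ifs <;> simp <;> omega
      · intro i i' hi hi'
        rw [← h22 i i' (by omega) (by omega)]
        simp only [Matrix.submatrix_apply]
        congr 1 <;> (apply Fin.ext; simp [Fin.succAbove, Fin.lt_def]; split_ifs <;> simp <;> omega)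

theorem perp_apply {m n : ℕ} (M : Matrix (Fin (2 * m)) (Fin (2 * m)) R)
    (N : Matrix (Fin (2 * n)) (Fin (2 * n)) R) (i j : Fin (2 * m) ⊕ Fin (2 * n)) :
    perp M N (finSumFinEquiv.trans (finCongr (Nat.mul_add 2 m n).symm) i)
      (finSumFinEquiv.trans (finCongr (Nat.mul_add 2 m n).symm) j) =
      Matrix.fromBlocks M 0 0 N i j := by
  rw [perp, Matrix.reindex_apply, Matrix.submatrix_apply, Equiv.symm_apply_apply,
    Equiv.symm_apply_apply]

theorem pf_perp {m n : ℕ} (M : Matrix (Fin (2 * m)) (Fin (2 * m)) R)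
    (N : Matrix (Fin (2 * n)) (Fin (2 * n)) R) : pf (m + n) (perp M N) = pf m M * pf n N := by
  refine pf_block M N _ rfl ?_ ?_ ?_
  · intro i j hi hj
    exact perp_apply M N (Sum.inl ⟨i, hi⟩) (Sum.inl ⟨j, hj⟩)
  · intro i j hi hj
    have := perp_apply M N (Sum.inl ⟨i, hi⟩) (Sum.inr ⟨j - 2 * m, by omega⟩)
    rw [Matrix.fromBlocks_apply₁₂] at this
    rw [← Matrix.zero_apply, ← this]
    congr 1
    apply Fin.ext
    simp
    omega
  · intro i j hi hj
    have := perp_apply M N (Sum.inr i) (Sum.inr j)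
    rw [Matrix.fromBlocks_apply₂₂] at this
    convert this using 2 <;> (apply Fin.ext; simp [Nat.add_comm])

theorem toLinearMap₂'_self_eq_zero {ι : Type*} [Fintype ι] [DecidableEq ι] (M : Matrix ι ι R)
    (hM : M.transpose = -M) (hd : ∀ i, M i i = 0) (x : ι → R) :
    Matrix.toLinearMap₂' R M x x = 0 := by
  have hs : ∀ i j, M j i = - M i j := fun i j => congrFun (congrFun hM i) j
  rw [Matrix.toLinearMap₂'_apply, ← Finset.sum_product' Finset.univ Finset.univ
    (fun i j => x i • x j • M i j)]
  refine Finset.sum_involution (fun p _ => p.swap) ?_ ?_ ?_ ?_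
  · rintro ⟨i, j⟩ _
    simp only [Prod.swap, smul_eq_mul, hs i j]
    ring
  · rintro ⟨i, j⟩ _ h h'
    obtain rfl : j = i := congrArg Prod.fst h'
    exact h (by simp [hd])
  · simp
  · simp

/-- The inverse is the Pfaffian adjugate. Replacing the `k`-th basis vector by `e i` in the
alternating Pfaffian gives `1` or `0` according as `i = k` or not, and expanding along `e i`
exhibits this value as `B (e i) u` for a vector `u` independent of `i`. -/
theorem isUnit_of_pf_eq_one {n : ℕ} (M : Matrix (Fin (2 * n)) (Fin (2 * n)) R)
    (hM : M.transpose = -M) (hd : ∀ i, M i i = 0) (h : pf n M = 1) : IsUnit M := by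
  cases n with
  | zero =>
    rw [show M = 1 by ext i; exact i.elim0]
    exact isUnit_one
  | succ n =>
    let B : LinearMap.BilinForm R (Fin (2 * (n + 1)) → R) := Matrix.toLinearMap₂' R M
    obtain ⟨F, hF, -⟩ := exists_pf_gram B (toLinearMap₂'_self_eq_zero M hM hd) (n + 1)
    let e : Fin (2 * n + 1 + 1) → (Fin (2 * (n + 1)) → R) := fun i => Pi.single i 1
    have hBe : gram B e = M := by
      ext i j
      change B (e i) (e j) = M i j
      simp only [B, e]
      rw [Matrix.toLinearMap₂'_apply']
      simp
    have hu : ∀ k, ∃ u, ∀ i, B (e i) u = if i = k then 1 else 0 := by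
      intro k
      let w := k.removeNth e
      refine ⟨(-1 : R) ^ k.1 • ∑ j : Fin (2 * n + 1), (((-1) ^ j.1 * pf n (gram B (j.removeNth w)))
        • w j), fun i => ?_⟩
      have h1 : F (Fin.cons (e i) w) = ∑ j : Fin (2 * n + 1), (-1) ^ j.1 * B (e i) (w j) *
          pf n (gram B (j.removeNth w)) := by
        rw [hF, pf_succ]
        rfl
      have h2 : (-1) ^ k.1 * F (Fin.cons (e i) w) = if i = k then 1 else 0 := by
        split_ifs with hik
        · subst hik
          have h3 := AlternatingMap.neg_one_pow_smul_map_insertNth F i (e i) w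
          have h4 : i.insertNth (e i) w = e := Fin.insertNth_self_removeNth i e
          erw [← h3, h4, hF, hBe, h]
          rcases Nat.even_or_odd i.1 with h | h <;> simp [h.neg_one_pow]
        · obtain ⟨j, hj⟩ := Fin.exists_succAbove_eq hik
          rw [F.map_eq_zero_of_eq _ (i := (0 : Fin (2 * n + 1 + 1))) (j := j.succ) _
            (Fin.succ_ne_zero _).symm, mul_zero]
          change e i = e (k.succAbove j)
          rw [hj]
      rw [← h2, h1, map_smul, map_sum, smul_eq_mul]
      congr 1
      refine Finset.sum_congr rfl fun j _ => ?_
      rw [map_smul, smul_eq_mul]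
      ring
    choose u hu using hu
    have hN : M * Matrix.of (fun l k => u k l) = 1 := by
      ext i k
      have h5 := hu k i
      simp only [B, e] at h5
      rw [Matrix.toLinearMap₂'_apply'] at h5
      rw [Matrix.one_apply, ← h5, Matrix.mul_apply]
      simp only [single_dotProduct, one_mul]
      rfl
    exact IsUnit.of_mul_eq_one _ hN

end Pfaffian

/-! ### Determinants on projective modules and the action of SL on unimodular functionals -/

section Determinant

variable {R : Type*} [CommRing R]
variable {V : Type*} [AddCommGroup V] [Module R V] [Module.Finite R V] [Module.Projective R V]
variable {W : Type*} [AddCommGroup W] [Module R W] [Module.Finite R W] [Module.Projective R W]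

theorem det_one_add_comp_comm {m n : ℕ} (A : (Fin m → R) →ₗ[R] (Fin n → R))
    (B : (Fin n → R) →ₗ[R] (Fin m → R)) :
    LinearMap.det (1 + A ∘ₗ B : Module.End R (Fin n → R)) =
      LinearMap.det (1 + B ∘ₗ A : Module.End R (Fin m → R)) := by
  rw [← LinearMap.det_toMatrix', ← LinearMap.det_toMatrix', map_add, map_add,
    LinearMap.toMatrix'_one, LinearMap.toMatrix'_one, LinearMap.toMatrix'_comp,
    LinearMap.toMatrix'_comp, Matrix.det_one_add_mul_comm]

theorem projDet_one_add_comp (A : W →ₗ[R] V) (B : V →ₗ[R] W) :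
    projDet (1 + A ∘ₗ B : Module.End R V) = projDet (1 + B ∘ₗ A : Module.End R W) := by
  obtain ⟨n, f, g, -, -, h⟩ := Module.Finite.exists_comp_eq_id_of_projective R V
  obtain ⟨m, f', g', -, -, h'⟩ := Module.Finite.exists_comp_eq_id_of_projective R W
  rw [projDet_eq_complDet f g h, projDet_eq_complDet f' g' h', complDet, complDet]
  have h0 := fun x => LinearMap.congr_fun h x
  have h0' := fun x => LinearMap.congr_fun h' x
  simp only [LinearMap.comp_apply, LinearMap.id_apply] at h0 h0'
  have e1 : g ∘ₗ (1 + A ∘ₗ B - 1 : Module.End R V) ∘ₗ f = (g ∘ₗ A ∘ₗ f') ∘ₗ (g' ∘ₗ B ∘ₗ f) := by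
    ext1 i
    ext1
    simp [h0']
  have e2 : g' ∘ₗ (1 + B ∘ₗ A - 1 : Module.End R W) ∘ₗ f' =
      (g' ∘ₗ B ∘ₗ f) ∘ₗ (g ∘ₗ A ∘ₗ f') := by
    ext1 i
    ext1
    simp [h0]
  rw [e1, e2, det_one_add_comp_comm]

/-- Sylvester's identity `det(1 + AB) = det(1 + BA)`. It compares determinants on different modules
and carries all the determinant computations below. -/
theorem projDet_eq_of_sub_one {φ : Module.End R V} {ψ : Module.End R W} (A : W →ₗ[R] V)
    (B : V →ₗ[R] W) (h : φ - 1 = A ∘ₗ B) (h' : ψ - 1 = B ∘ₗ A) : projDet φ = projDet ψ := by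
  rw [← add_sub_cancel 1 φ, ← add_sub_cancel 1 ψ, h, h', projDet_one_add_comp]

theorem mem_SL {φ : V ≃ₗ[R] V} : φ ∈ SL R V ↔ projDet (φ : Module.End R V) = 1 := Iff.rfl

/-- The transvection `v ↦ v + A (B v)`, where `B A = 0`. -/
def shear {V W : Type*} [AddCommGroup V] [Module R V] [AddCommGroup W] [Module R W]
    (A : W →ₗ[R] V) (B : V →ₗ[R] W) (h : ∀ w, B (A w) = 0) : V ≃ₗ[R] V :=
  LinearEquiv.ofLinearMap (LinearMap.id + A ∘ₗ B) (LinearMap.id - A ∘ₗ B)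
    (by ext v; simp [h]) (by ext v; simp [h])

@[simp]
theorem shear_apply {V W : Type*} [AddCommGroup V] [Module R V] [AddCommGroup W] [Module R W]
    (A : W →ₗ[R] V) (B : V →ₗ[R] W) (h : ∀ w, B (A w) = 0) (v : V) :
    shear A B h v = v + A (B v) := rfl

theorem shear_mem_SL (A : W →ₗ[R] V) (B : V →ₗ[R] W) (h : ∀ w, B (A w) = 0) :
    shear A B h ∈ SL R V := by
  rw [mem_SL, ← projDet_one (R := R) (P := W)]
  refine projDet_eq_of_sub_one A B ?_ ?_
  · ext v
    simp
  · ext w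
    simp [h]

theorem conj_mem_SL (e : V ≃ₗ[R] W) {φ : V ≃ₗ[R] V} (hφ : φ ∈ SL R V) :
    (e.symm.trans φ).trans e ∈ SL R W := by
  rw [mem_SL, ← mem_SL.1 hφ]
  refine projDet_eq_of_sub_one (e : V →ₗ[R] W) ((φ - 1 : Module.End R V) ∘ₗ (e.symm : W →ₗ[R] V))
    ?_ ?_
  · ext v
    simp
  · ext w
    simp

theorem prodCongr_mem_SL {φ : V ≃ₗ[R] V} (hφ : φ ∈ SL R V) :
    φ.prodCongr (LinearEquiv.refl R W) ∈ SL R (V × W) := by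
  rw [mem_SL, ← mem_SL.1 hφ]
  refine projDet_eq_of_sub_one (LinearMap.inl R V W ∘ₗ (φ - 1 : Module.End R V))
    (LinearMap.fst R V W) ?_ ?_
  · ext v <;> simp
  · ext w
    simp

theorem projDet_pi {n : ℕ} (φ : Module.End R (Fin n → R)) : projDet φ = LinearMap.det φ := by
  rw [projDet_eq_complDet LinearMap.id LinearMap.id rfl, complDet]
  simp

/-- If `φ` fixes the last basis vector, it has the same determinant as the automorphism that it
induces on the quotient. -/
theorem mem_SL_of_fst {φ : (V × R) ≃ₗ[R] V × R} (hφ : φ ∈ SL R (V × R)) (hf : φ (0, 1) = (0, 1))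
    (φ' : V ≃ₗ[R] V) (h : ∀ v, (φ (v, 0)).1 = φ' v) : φ' ∈ SL R V := by
  rw [mem_SL, ← mem_SL.1 hφ]
  symm
  -- Since `φ - 1` kills `(0, 1)`, it factors through the projection to `V`.
  refine projDet_eq_of_sub_one ((φ - 1 : Module.End R (V × R)) ∘ₗ LinearMap.inl R V R)
    (LinearMap.fst R V R) ?_ ?_
  · refine LinearMap.prod_ext ?_ ?_
    · ext v <;> simp
    · ext <;> simp [hf, ← Prod.zero_eq_mk]
  · ext v
    simp [h]

/-- `SL(V)` acts transitively on `Um(V)`. -/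
def UmTransitive (R V : Type*) [CommRing R] [AddCommGroup V] [Module R V] [Module.Finite R V]
    [Module.Projective R V] : Prop :=
  ∀ a ∈ Um R V, ∀ b ∈ Um R V, ∃ φ ∈ SL R V, a ∘ₗ (φ : V →ₗ[R] V) = b

theorem UmTransitive.of_equiv (e : V ≃ₗ[R] W) (h : UmTransitive R V) : UmTransitive R W := by
  intro a ha b hb
  obtain ⟨φ, hφ, h⟩ := h (a ∘ₗ e) (ha.comp e.surjective) (b ∘ₗ e) (hb.comp e.surjective)
  refine ⟨_, conj_mem_SL e hφ, ?_⟩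
  ext w
  have := LinearMap.congr_fun h (e.symm w)
  simpa using this

theorem umTransitive_of_forall (b : V →ₗ[R] R)
    (h : ∀ a ∈ Um R V, ∃ φ ∈ SL R V, a ∘ₗ (φ : V →ₗ[R] V) = b) : UmTransitive R V := by
  intro a ha a' ha'
  obtain ⟨φ, hφ, h1⟩ := h a ha
  obtain ⟨φ', hφ', h2⟩ := h a' ha'
  refine ⟨φ * φ'⁻¹, mul_mem hφ (inv_mem hφ'), ?_⟩
  ext v
  have e : φ' (φ'⁻¹ v) = v := φ'.apply_symm_apply v
  have h3 := LinearMap.congr_fun h1 (φ'⁻¹ v)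
  have h4 := LinearMap.congr_fun h2 (φ'⁻¹ v)
  simp only [LinearMap.comp_apply, LinearEquiv.coe_coe, e] at h3 h4
  simp only [LinearMap.comp_apply, LinearEquiv.coe_coe, LinearEquiv.mul_apply]
  rw [h3, h4]

end Determinant

/-! ### Isometries, orthogonal sums and hyperbolic planes -/

section Isometry

variable {R : Type*} [CommRing R]
variable {V V' W W' : Type*} [AddCommGroup V] [Module R V] [AddCommGroup V'] [Module R V']
  [AddCommGroup W] [Module R W] [AddCommGroup W'] [Module R W']

/-- The bilinear forms `α` and `β` are isometric. -/
def Isometric (α : LinearMap.BilinForm R V) (β : LinearMap.BilinForm R W) : Prop :=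
  ∃ e : V ≃ₗ[R] W, ∀ x y, β (e x) (e y) = α x y

theorem Isometric.refl (α : LinearMap.BilinForm R V) : Isometric α α :=
  ⟨LinearEquiv.refl R V, fun _ _ => rfl⟩

theorem Isometric.symm {α : LinearMap.BilinForm R V} {β : LinearMap.BilinForm R W}
    (h : Isometric α β) : Isometric β α := by
  obtain ⟨e, he⟩ := h
  exact ⟨e.symm, fun x y => by rw [← he, e.apply_symm_apply, e.apply_symm_apply]⟩

theorem Isometric.trans {α : LinearMap.BilinForm R V} {β : LinearMap.BilinForm R W}
    {γ : LinearMap.BilinForm R V'} (h : Isometric α β) (h' : Isometric β γ) : Isometric α γ := by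
  obtain ⟨e, he⟩ := h
  obtain ⟨f, hf⟩ := h'
  exact ⟨e.trans f, fun x y => by rw [← he, ← hf]; rfl⟩

@[simp]
theorem formPerp_apply (α : LinearMap.BilinForm R V) (β : LinearMap.BilinForm R W) (x y : V × W) :
    formPerp α β x y = α x.1 y.1 + β x.2 y.2 := rfl

theorem Isometric.formPerp {α : LinearMap.BilinForm R V} {α' : LinearMap.BilinForm R V'}
    {β : LinearMap.BilinForm R W} {β' : LinearMap.BilinForm R W'} (h : Isometric α α')
    (h' : Isometric β β') : Isometric (formPerp α β) (formPerp α' β') := by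
  obtain ⟨e, he⟩ := h
  obtain ⟨f, hf⟩ := h'
  exact ⟨e.prodCongr f, fun x y => by simp [he, hf]⟩

theorem isometric_formPerp_assoc (α : LinearMap.BilinForm R V) (β : LinearMap.BilinForm R W)
    (γ : LinearMap.BilinForm R V') :
    Isometric (formPerp (formPerp α β) γ) (formPerp α (formPerp β γ)) :=
  ⟨LinearEquiv.prodAssoc R V W V', fun x y => by simp [add_assoc]⟩

theorem isometric_formPerp_comm (α : LinearMap.BilinForm R V) (β : LinearMap.BilinForm R W) :
    Isometric (formPerp α β) (formPerp β α) :=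
  ⟨LinearEquiv.prodComm R V W, fun x y => by simp [add_comm]⟩

/-- The orthogonal sum of `α` and a hyperbolic plane. -/
def hyp (α : LinearMap.BilinForm R V) : LinearMap.BilinForm R ((V × R) × R) :=
  α.compl₁₂ (LinearMap.fst R V R ∘ₗ LinearMap.fst R _ R)
      (LinearMap.fst R V R ∘ₗ LinearMap.fst R _ R) +
    ((LinearMap.mul R R).compl₁₂ (LinearMap.snd R V R ∘ₗ LinearMap.fst R _ R)
        (LinearMap.snd R _ R) -
      (LinearMap.mul R R).compl₁₂ (LinearMap.snd R _ R)
        (LinearMap.snd R V R ∘ₗ LinearMap.fst R _ R))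

@[simp]
theorem hyp_apply (α : LinearMap.BilinForm R V) (x y : (V × R) × R) :
    hyp α x y = α x.1.1 y.1.1 + (x.1.2 * y.2 - x.2 * y.1.2) := rfl

/-- `(V ⊕ Rᵏ) ⊕ R ≅ V ⊕ Rᵏ⁺¹`. -/
def snocEquiv (R V : Type*) [CommRing R] [AddCommGroup V] [Module R V] (k : ℕ) :
    ((V × (Fin k → R)) × R) ≃ₗ[R] V × (Fin (k + 1) → R) where
  toFun x := (x.1.1, Fin.snoc (α := fun _ => R) x.1.2 x.2)
  invFun x := ((x.1, Fin.init x.2), x.2 (Fin.last k))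
  left_inv x := by simp
  right_inv x := by simp
  map_add' x y := by
    refine Prod.ext rfl ?_
    ext i
    refine Fin.lastCases ?_ (fun i => ?_) i <;> simp
  map_smul' c x := by
    refine Prod.ext rfl ?_
    ext i
    refine Fin.lastCases ?_ (fun i => ?_) i <;> simp

/-- `((V ⊕ R²ⁿ) ⊕ R) ⊕ R ≅ V ⊕ R²ⁿ⁺²`. -/
def snocEquiv₂ (R V : Type*) [CommRing R] [AddCommGroup V] [Module R V] (n : ℕ) :
    (((V × (Fin (2 * n) → R)) × R) × R) ≃ₗ[R] V × (Fin (2 * (n + 1)) → R) :=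
  ((snocEquiv R V (2 * n)).prodCongr (LinearEquiv.refl R R)).trans (snocEquiv R V (2 * n + 1))

theorem snocEquiv₂_apply (n : ℕ) (x : ((V × (Fin (2 * n) → R)) × R) × R) :
    snocEquiv₂ R V n x = (x.1.1.1, Fin.snoc (α := fun _ => R)
      (Fin.snoc (α := fun _ => R) x.1.1.2 x.1.2 : Fin (2 * n + 1) → R) x.2) := rfl

theorem psiForm_apply (n : ℕ) (v w : Fin (2 * n) → R) :
    psiForm R n v w = ∑ i, ∑ j, v i * w j * psi R n i j := by
  rw [psiForm, Matrix.toLinearMap₂'_apply]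
  simp [mul_assoc]

theorem psiForm_succ (n : ℕ) (v w : Fin (2 * n) → R) (a b c d : R) :
    psiForm R (n + 1)
      (Fin.snoc (α := fun _ => R) (Fin.snoc (α := fun _ => R) v a : Fin (2 * n + 1) → R) b)
      (Fin.snoc (α := fun _ => R) (Fin.snoc (α := fun _ => R) w c : Fin (2 * n + 1) → R) d) =
      psiForm R n v w + (a * d - b * c) := by
  -- `Q` is `ψ_{2n+2}` with its index type read as `Fin (2 * n + 1 + 1)`, so that the last two rows
  -- and columns can be peeled off.
  obtain ⟨Q, hQ⟩ : ∃ Q : Fin (2 * n + 1 + 1) → Fin (2 * n + 1 + 1) → R,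
    ∀ i j, Q i j = psi R (n + 1) i j := ⟨_, fun _ _ => rfl⟩
  have h0 : ∀ i j : Fin (2 * n), Q i.castSucc.castSucc j.castSucc.castSucc =
    psi R n i j := fun i j => by rw [hQ]; rfl
  have h : ∀ i : Fin (2 * n),
      Q i.castSucc.castSucc (Fin.last (2 * n)).castSucc = 0 ∧
      Q i.castSucc.castSucc (Fin.last (2 * n + 1)) = 0 ∧
      Q (Fin.last (2 * n)).castSucc i.castSucc.castSucc = 0 ∧
      Q (Fin.last (2 * n + 1)) i.castSucc.castSucc = 0 := fun i => by
    have := i.2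
    simp only [hQ, psi, Matrix.of_apply, Fin.val_castSucc, Fin.val_last]
    refine ⟨?_, ?_, ?_, ?_⟩ <;> rw [if_neg (by omega), if_neg (by omega)]
  have h5 : Q (Fin.last (2 * n)).castSucc (Fin.last (2 * n + 1)) = 1 := by
    simp [hQ, psi]
  have h6 : Q (Fin.last (2 * n + 1)) (Fin.last (2 * n)).castSucc = -1 := by
    simp [hQ, psi]
  have h7 : Q (Fin.last (2 * n)).castSucc (Fin.last (2 * n)).castSucc = 0 := by
    simp [hQ, psi]
  have h8 : Q (Fin.last (2 * n + 1)) (Fin.last (2 * n + 1)) = 0 := by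
    simp [hQ, psi]
  rw [psiForm_apply, psiForm_apply]
  simp only [← hQ]
  change ∑ i : Fin (2 * n + 1 + 1), ∑ j : Fin (2 * n + 1 + 1),
    (Fin.snoc (α := fun _ => R) (Fin.snoc (α := fun _ => R) v a) b : Fin (2 * n + 1 + 1) → R) i *
    (Fin.snoc (α := fun _ => R) (Fin.snoc (α := fun _ => R) w c) d : Fin (2 * n + 1 + 1) → R) j *
    Q i j = _
  simp only [Fin.sum_univ_castSucc (n := 2 * n + 1), Fin.sum_univ_castSucc (n := 2 * n),
    Fin.snoc_castSucc, Fin.snoc_last]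
  simp only [h0, (h _).1, (h _).2.1, (h _).2.2.1, (h _).2.2.2, h5, h6, h7, h8, mul_zero, add_zero,
    Finset.sum_const_zero, zero_add]
  ring

theorem isometric_hyp_formPerp_psiForm (α : LinearMap.BilinForm R V) (n : ℕ) :
    Isometric (hyp (formPerp α (psiForm R n))) (formPerp α (psiForm R (n + 1))) :=
  ⟨snocEquiv₂ R V n, fun x y => by
    rw [snocEquiv₂_apply, snocEquiv₂_apply, formPerp_apply, psiForm_succ]
    simp [add_assoc]⟩

end Isometry

/-! ### The form given by a trivialized determinant -/

section Plane

variable {R : Type*} [CommRing R] {P : Type*} [AddCommGroup P] [Module R P]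

/-- A non-degenerate alternating form `χ` on a module of rank two: it satisfies the Plücker relation
and represents `1` as a sum of its values. -/
structure PlaneFrame (χ : LinearMap.BilinForm R P) (m : ℕ) where
  /-- the first vectors of the pairs -/
  x : Fin m → P
  /-- the second vectors of the pairs -/
  y : Fin m → P
  alt : ∀ z, χ z z = 0
  plucker : ∀ u v w, χ u v • w + χ v w • u + χ w u • v = 0
  sum_eq : ∑ i, χ (x i) (y i) = 1

theorem chi₀_apply (θ₀ : R ≃ₗ[R] ⋀[R]^2 P) (x y : P) :
    chi₀ θ₀ x y = θ₀.symm (exteriorPower.ιMulti R 2 ![x, y]) := rfl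

theorem chi₀_self (θ₀ : R ≃ₗ[R] ⋀[R]^2 P) (x : P) : chi₀ θ₀ x x = 0 := by
  rw [chi₀_apply, (exteriorPower.ιMulti R 2 (M := P)).map_eq_zero_of_eq _
    (i := (0 : Fin 2)) (j := 1) rfl (by simp), map_zero]

/-- An alternating form is a functional on `⋀² P ≅ R`, that is, multiplication by a scalar. The 2 ×
2 Pfaffian serves to repackage `β` as an alternating map. -/
theorem exists_eq_mul_chi₀ (θ₀ : R ≃ₗ[R] ⋀[R]^2 P) (β : LinearMap.BilinForm R P)
    (hβ : ∀ x, β x x = 0) : ∃ c, ∀ x y, β x y = c * chi₀ θ₀ x y := by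
  obtain ⟨F, hF, -⟩ := exists_pf_gram β hβ 1
  refine ⟨exteriorPower.alternatingMapLinearEquiv F (θ₀ 1), fun x y => ?_⟩
  have h1 : β x y = F ![x, y] := by
    rw [hF]
    simp [pf, gram]
  rw [h1, ← exteriorPower.alternatingMapLinearEquiv_apply_ιMulti F ![x, y],
    ← θ₀.apply_symm_apply (exteriorPower.ιMulti R 2 ![x, y]), ← chi₀_apply]
  have h2 : θ₀ (chi₀ θ₀ x y) = chi₀ θ₀ x y • θ₀ 1 := by rw [← map_smul, smul_eq_mul, mul_one]
  rw [h2, map_smul, smul_eq_mul, mul_comm]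

theorem exists_sum_chi₀_eq_one (θ₀ : R ≃ₗ[R] ⋀[R]^2 P) :
    ∃ (m : ℕ) (x y : Fin m → P), ∑ i, chi₀ θ₀ (x i) (y i) = 1 := by
  have h : θ₀ 1 ∈ Submodule.span R (Set.range (exteriorPower.ιMulti R 2 (M := P))) := by
    rw [exteriorPower.ιMulti_span]
    trivial
  rw [Submodule.mem_span_set'] at h
  obtain ⟨m, c, g, h⟩ := h
  choose v hv using fun i => (g i).2
  refine ⟨m, fun i => c i • v i 0, fun i => v i 1, ?_⟩
  have h' := congrArg θ₀.symm h
  rw [map_sum, θ₀.symm_apply_apply] at h'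
  rw [← h']
  refine Finset.sum_congr rfl fun i _ => ?_
  rw [map_smul, map_smul, LinearMap.smul_apply, chi₀_apply, ← hv i]
  have e : ![v i 0, v i 1] = v i := by
    ext j
    fin_cases j <;> rfl
  rw [e]

theorem chi₀_neg (θ₀ : R ≃ₗ[R] ⋀[R]^2 P) (x y : P) : chi₀ θ₀ y x = - chi₀ θ₀ x y := by
  have h := chi₀_self θ₀ (x + y)
  simp only [map_add, LinearMap.add_apply, chi₀_self, zero_add, add_zero] at h
  exact eq_neg_of_add_eq_zero_left h

/-- The radical of the annihilator of `r` contains all values of the form, and these generate the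
unit ideal. -/
theorem eq_zero_of_forall_sq_chi₀_mul (θ₀ : R ≃ₗ[R] ⋀[R]^2 P) (r : R)
    (h : ∀ x y, chi₀ θ₀ x y ^ 2 * r = 0) : r = 0 := by
  obtain ⟨m, x, y, hs⟩ := exists_sum_chi₀_eq_one θ₀
  let J : Ideal R := LinearMap.ker (LinearMap.toSpanSingleton R R r)
  have hJ : J.radical = ⊤ := by
    rw [Ideal.eq_top_iff_one, ← hs]
    exact Ideal.sum_mem _ fun i _ => ⟨2, by simpa [J] using h (x i) (y i)⟩
  rw [Ideal.radical_eq_top, Ideal.eq_top_iff_one] at hJ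
  simpa [J] using hJ

/-- It suffices to test against a functional `f`. For fixed `z`, `f(x)χ(y,z) - f(y)χ(x,z)` is
alternating in `x, y`, hence equal to `c(z) χ(x,y)`. Specializing the arguments shows that `c + f`
is killed by all `χ(x,y)²`, so `c = -f`, which is the relation. -/
theorem chi₀_plucker [Module.Projective R P] (θ₀ : R ≃ₗ[R] ⋀[R]^2 P) (x y z : P) :
    chi₀ θ₀ x y • z + chi₀ θ₀ y z • x + chi₀ θ₀ z x • y = 0 := by
  rw [← Module.forall_dual_apply_eq_zero_iff R]
  intro f
  have hz : ∀ z, ∃ c, ∀ x y, f x * chi₀ θ₀ y z - f y * chi₀ θ₀ x z = c * chi₀ θ₀ x y := by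
    intro z
    let β : LinearMap.BilinForm R P :=
      (LinearMap.mul R R).compl₁₂ f ((chi₀ θ₀).flip z) -
        (LinearMap.mul R R).compl₁₂ ((chi₀ θ₀).flip z) f
    obtain ⟨c, hc⟩ := exists_eq_mul_chi₀ θ₀ β (fun x => by simp [β, mul_comm])
    refine ⟨c, fun x y => ?_⟩
    rw [← hc]
    simp [β, mul_comm]
  choose c hc using hz
  have h1 : ∀ x y, (c y + f y) * chi₀ θ₀ x y = 0 := by
    intro x y
    have := hc y x y
    rw [chi₀_self] at this
    linear_combination -this
  have h2 : ∀ z, c z + f z = 0 := by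
    intro z
    refine eq_zero_of_forall_sq_chi₀_mul θ₀ _ fun x y => ?_
    have e1 := hc z x y
    have e2 := hc y x z
    rw [chi₀_neg θ₀ y z] at e2
    linear_combination (-chi₀ θ₀ x y) * (e1 + e2) - chi₀ θ₀ x z * h1 x y
  have h3 := hc z x y
  simp only [map_add, map_smul, smul_eq_mul]
  rw [chi₀_neg θ₀ x z]
  linear_combination h3 + h2 z * chi₀ θ₀ x y

theorem exists_planeFrame [Module.Projective R P] (θ₀ : R ≃ₗ[R] ⋀[R]^2 P) :
    ∃ m, Nonempty (PlaneFrame (chi₀ θ₀) m) := by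
  obtain ⟨m, x, y, h⟩ := exists_sum_chi₀_eq_one θ₀
  exact ⟨m, ⟨x, y, chi₀_self θ₀, chi₀_plucker θ₀, h⟩⟩

end Plane

/-! ### Coordinates and Pfaffian of the standard form -/

section StandardForm

variable {R : Type*} [CommRing R]

theorem exists_snoc₂ (n : ℕ) (v : Fin (2 * (n + 1)) → R) : ∃ (v' : Fin (2 * n) → R) (a b : R),
    v = (Fin.snoc (α := fun _ => R) (Fin.snoc (α := fun _ => R) v' a : Fin (2 * n + 1) → R) b) := by
  have h : v = (snocEquiv₂ R R n ((snocEquiv₂ R R n).symm (0, v))).2 := by simp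
  rw [snocEquiv₂_apply] at h
  exact ⟨_, _, _, h⟩

theorem psiForm_eq_sum (n : ℕ) (v w : Fin (2 * n) → R) :
    psiForm R n v w = ∑ i : Fin n, (v ⟨2 * i.1, by omega⟩ * w ⟨2 * i.1 + 1, by omega⟩ -
      v ⟨2 * i.1 + 1, by omega⟩ * w ⟨2 * i.1, by omega⟩) := by
  induction n with
  | zero =>
    rw [psiForm_apply]
    rfl
  | succ n ih =>
    obtain ⟨v, a, b, rfl⟩ := exists_snoc₂ n v
    obtain ⟨w, c, d, rfl⟩ := exists_snoc₂ n w
    rw [psiForm_succ, ih, Fin.sum_univ_castSucc]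
    have h1 : ∀ (v : Fin (2 * n) → R) (a b : R) (k : ℕ) (h : k < 2 * n),
        (Fin.snoc (α := fun _ => R) (Fin.snoc (α := fun _ => R) v a : Fin (2 * n + 1) → R) b :
          Fin (2 * n + 1 + 1) → R) ⟨k, by omega⟩ = v ⟨k, h⟩ := by
      intro v a b k h
      simp [Fin.snoc, h, show k < 2 * n + 1 by omega]
    have h2 : ∀ (v : Fin (2 * n) → R) (a b : R),
        (Fin.snoc (α := fun _ => R) (Fin.snoc (α := fun _ => R) v a : Fin (2 * n + 1) → R) b :
          Fin (2 * n + 1 + 1) → R) ⟨2 * n, by omega⟩ = a := by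
      intro v a b
      simp [Fin.snoc]
    have h3 : ∀ (v : Fin (2 * n) → R) (a b : R),
        (Fin.snoc (α := fun _ => R) (Fin.snoc (α := fun _ => R) v a : Fin (2 * n + 1) → R) b :
          Fin (2 * n + 1 + 1) → R) ⟨2 * n + 1, by omega⟩ = b := by
      intro v a b
      simp [Fin.snoc]
    congr 1
    · refine Finset.sum_congr rfl fun i _ => ?_
      have := i.2
      erw [h1 v a b (2 * i.1) (by omega), h1 v a b (2 * i.1 + 1) (by omega),
        h1 w c d (2 * i.1) (by omega), h1 w c d (2 * i.1 + 1) (by omega)]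
    · erw [h2 v a b, h2 w c d, h3 v a b, h3 w c d]

theorem psiForm_self (n : ℕ) (v : Fin (2 * n) → R) : psiForm R n v v = 0 := by
  rw [psiForm_eq_sum]
  exact Finset.sum_eq_zero fun i _ => by ring

theorem psiForm_neg (n : ℕ) (v w : Fin (2 * n) → R) : psiForm R n v w = - psiForm R n w v := by
  rw [psiForm_eq_sum, psiForm_eq_sum, ← Finset.sum_neg_distrib]
  exact Finset.sum_congr rfl fun i _ => by ring

theorem psiForm_one (v w : Fin (2 * 1) → R) :
    psiForm R 1 v w = v 0 * w 1 - v 1 * w 0 := by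
  rw [psiForm_eq_sum]
  simp

theorem gram_toLinearMap₂' {n : ℕ} (M : Matrix (Fin n) (Fin n) R) :
    gram (Matrix.toLinearMap₂' R M) (Pi.basisFun R (Fin n)) = M := by
  ext i j
  simp [gram, Matrix.toLinearMap₂'_apply']

theorem pf_congr {n : ℕ} (M E : Matrix (Fin (2 * n)) (Fin (2 * n)) R) (hM : M.transpose = -M)
    (hd : ∀ i, M i i = 0) : pf n (E.transpose * M * E) = E.det * pf n M := by
  have h := pf_gram_comp (Matrix.toLinearMap₂' R M) (toLinearMap₂'_self_eq_zero M hM hd)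
    (Pi.basisFun R (Fin (2 * n))) (Matrix.toLin' E)
  rw [gram_toLinearMap₂', LinearMap.det_toLin'] at h
  rw [← h]
  congr 1
  ext i j
  simp only [gram, Matrix.of_apply, Function.comp_apply, Pi.basisFun_apply,
    Matrix.toLinearMap₂'_apply']
  simp only [Matrix.toLin'_apply, Matrix.mulVec_single_one]
  rw [Matrix.mul_assoc, Matrix.mul_apply]
  rfl

theorem psi_transpose (n : ℕ) : (psi R n).transpose = - psi R n := by
  ext i j
  simp only [psi, Matrix.transpose_apply, Matrix.neg_apply, Matrix.of_apply]
  split_ifs <;> first | omega | simp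

theorem psi_diag (n : ℕ) (i : Fin (2 * n)) : psi R n i i = 0 := by
  simp [psi]

theorem pf_psi (n : ℕ) : pf n (psi R n) = 1 := by
  induction n with
  | zero => rfl
  | succ n ih =>
    rw [pf_succ, Finset.sum_eq_single 0]
    · have e : (psi R (n + 1)).submatrix (fun i => ((0 : Fin (2 * n + 1)).succAbove i).succ)
          (fun i => ((0 : Fin (2 * n + 1)).succAbove i).succ) = psi R n := by
        ext i j
        simp only [psi, Matrix.submatrix_apply, Matrix.of_apply, Fin.succAbove_zero, Fin.val_succ]
        congr 1
        · simp only [eq_iff_iff]; omega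
        · congr 1
          simp only [eq_iff_iff]; omega
      have h0 : psi R (n + 1) 0 (Fin.succ (0 : Fin (2 * n + 1))) = 1 := by
        simp only [psi, Matrix.of_apply, Fin.val_succ]
        rw [if_pos (by simp)]
      rw [e, ih, h0]
      simp
    · intro j _ hj
      have : j.1 ≠ 0 := fun h => hj (Fin.ext h)
      have h0 : psi R (n + 1) 0 j.succ = 0 := by
        simp only [psi, Matrix.of_apply, Fin.val_succ]
        rw [if_neg (by simp; omega), if_neg (by simp)]
      rw [h0]
      ring
    · simp

theorem projDet_eq_det {V : Type*} [AddCommGroup V] [Module R V] [Module.Finite R V]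
    [Module.Projective R V] {n : ℕ} (b : Module.Basis (Fin n) R V) (φ : Module.End R V) :
    projDet φ = LinearMap.det φ := by
  let e := b.equivFun
  have h : projDet φ = projDet ((e : V →ₗ[R] (Fin n → R)) ∘ₗ φ ∘ₗ (e.symm : (Fin n → R) →ₗ[R] V)
      : Module.End R (Fin n → R)) := by
    refine projDet_eq_of_sub_one ((φ - 1) ∘ₗ (e.symm : (Fin n → R) →ₗ[R] V))
      (e : V →ₗ[R] (Fin n → R)) ?_ ?_
    · ext v
      simp
    · ext1 i
      ext1
      simp
  rw [h, projDet_pi]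
  exact LinearMap.det_conj φ e

end StandardForm

/-! ### The embedding into a standard form and the relative Pfaffian -/

namespace PlaneFrame

variable {R : Type*} [CommRing R] {P : Type*} [AddCommGroup P] [Module R P]
  {χ : LinearMap.BilinForm R P} {m : ℕ}

theorem neg (D : PlaneFrame χ m) (u v : P) : χ v u = - χ u v := by
  have h := D.alt (u + v)
  simp only [map_add, LinearMap.add_apply, D.alt, zero_add, add_zero] at h
  exact eq_neg_of_add_eq_zero_left h

theorem plucker₄ (D : PlaneFrame χ m) (u v w z : P) :
    χ u v * χ w z + χ v w * χ u z + χ w u * χ v z = 0 := by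
  have h := congrArg (fun t => χ t z) (D.plucker u v w)
  simpa using h

/-- The isometric embedding of `(P, χ)` into `(R²ᵐ, ψ_{2m})`. -/
def emb (D : PlaneFrame χ m) : P →ₗ[R] (Fin (2 * m) → R) where
  toFun z k := if k.1 % 2 = 0 then χ z (D.y ⟨k.1 / 2, by omega⟩) else χ (D.x ⟨k.1 / 2, by omega⟩) z
  map_add' z w := by
    ext k
    simp only [map_add, LinearMap.add_apply, Pi.add_apply]
    split_ifs <;> rfl
  map_smul' c z := by
    ext k
    simp only [map_smul, LinearMap.smul_apply, Pi.smul_apply, RingHom.id_apply]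
    split_ifs <;> rfl

/-- The adjoint of `emb`. -/
def ret (D : PlaneFrame χ m) : (Fin (2 * m) → R) →ₗ[R] P where
  toFun v := ∑ i : Fin m, (v ⟨2 * i.1, by omega⟩ • D.x i + v ⟨2 * i.1 + 1, by omega⟩ • D.y i)
  map_add' v w := by
    rw [← Finset.sum_add_distrib]
    refine Finset.sum_congr rfl fun i _ => ?_
    simp only [Pi.add_apply, add_smul]
    abel
  map_smul' c v := by
    rw [Finset.smul_sum]
    refine Finset.sum_congr rfl fun i _ => ?_
    simp [smul_smul]

theorem emb_even (D : PlaneFrame χ m) (z : P) (i : Fin m) :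
    D.emb z ⟨2 * i.1, by omega⟩ = χ z (D.y i) := by
  simp [emb]

theorem emb_odd (D : PlaneFrame χ m) (z : P) (i : Fin m) :
    D.emb z ⟨2 * i.1 + 1, by omega⟩ = χ (D.x i) z := by
  have h : (2 * i.1 + 1) / 2 = i.1 := by omega
  have h' : (2 * i.1 + 1) % 2 = 1 := by omega
  simp [emb, h, h']

-- Plücker gives `χ(xᵢ,yᵢ) z = χ(z,yᵢ) xᵢ + χ(xᵢ,z) yᵢ`; summing over `i` uses `∑ χ(xᵢ,yᵢ) = 1`.
@[simp]
theorem ret_emb (D : PlaneFrame χ m) (z : P) : D.ret (D.emb z) = z := by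
  simp only [ret, LinearMap.coe_mk, AddHom.coe_mk, emb_even, emb_odd]
  calc _ = ∑ i, χ (D.x i) (D.y i) • z := by
        refine Finset.sum_congr rfl fun i _ => ?_
        rw [eq_comm, ← sub_eq_zero, ← D.plucker (D.x i) (D.y i) z, D.neg z (D.y i),
          D.neg (D.x i) z]
        module
    _ = z := by rw [← Finset.sum_smul, D.sum_eq, one_smul]

/-- Adjointness of `emb` and `ret`. Together with `ret_emb` it makes `emb` isometric with orthogonal
complement `ker ret`. -/
theorem psiForm_emb (D : PlaneFrame χ m) (z : P) (v : Fin (2 * m) → R) :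
    psiForm R m (D.emb z) v = χ z (D.ret v) := by
  rw [psiForm_eq_sum]
  simp only [ret, LinearMap.coe_mk, AddHom.coe_mk, emb_even, emb_odd, map_sum, map_add, map_smul,
    smul_eq_mul]
  refine Finset.sum_congr rfl fun i _ => ?_
  rw [D.neg (D.x i) z]
  ring

theorem psiForm_emb_right (D : PlaneFrame χ m) (z : P) (v : Fin (2 * m) → R) :
    psiForm R m v (D.emb z) = χ (D.ret v) z := by
  rw [psiForm_neg, psiForm_emb, ← D.neg]

/-- The form `χ` is perfect. -/
theorem perfect (D : PlaneFrame χ m) (f : P →ₗ[R] R) : ∃ α, ∀ z, χ α z = f z := by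
  -- Apply `f` to the expansion `z = ∑ χ(z,yᵢ) xᵢ + χ(xᵢ,z) yᵢ`.
  refine ⟨∑ i, (f (D.y i) • D.x i - f (D.x i) • D.y i), fun z => ?_⟩
  conv_rhs => rw [← D.ret_emb z]
  simp only [ret, LinearMap.coe_mk, AddHom.coe_mk, emb_even, emb_odd, map_sum, map_add, map_smul,
    smul_eq_mul, LinearMap.sum_apply, map_sub, LinearMap.sub_apply, LinearMap.smul_apply]
  refine Finset.sum_congr rfl fun i _ => ?_
  rw [D.neg z (D.y i)]
  ring

/-- The extension of a form `ω` on `P ⊕ W` to `W ⊕ R²ᵐ` by the orthogonal complement of `P`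
in `(R²ᵐ, ψ_{2m})`. -/
def hat {W : Type*} [AddCommGroup W] [Module R W] (D : PlaneFrame χ m)
    (ω : LinearMap.BilinForm R (P × W)) : LinearMap.BilinForm R (W × (Fin (2 * m) → R)) :=
  ω.compl₁₂ ((D.ret ∘ₗ LinearMap.snd R W _).prod (LinearMap.fst R W _))
      ((D.ret ∘ₗ LinearMap.snd R W _).prod (LinearMap.fst R W _)) +
    (psiForm R m - χ.compl₁₂ D.ret D.ret).compl₁₂ (LinearMap.snd R W _) (LinearMap.snd R W _)

theorem hat_apply {W : Type*} [AddCommGroup W] [Module R W] (D : PlaneFrame χ m)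
    (ω : LinearMap.BilinForm R (P × W)) (x y : W × (Fin (2 * m) → R)) :
    D.hat ω x y = ω (D.ret x.2, x.1) (D.ret y.2, y.1) +
      (psiForm R m x.2 y.2 - χ (D.ret x.2) (D.ret y.2)) := rfl

theorem hat_self {W : Type*} [AddCommGroup W] [Module R W] (D : PlaneFrame χ m)
    (ω : LinearMap.BilinForm R (P × W)) (hω : ∀ x, ω x x = 0) (x : W × (Fin (2 * m) → R)) :
    D.hat ω x x = 0 := by
  rw [hat_apply, hω, psiForm_self, D.alt]
  simp

/-- `ω ⊥ ψ_{2m} ≅ χ ⊥ ω̂`. -/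
theorem isometric_formPerp_hat {W : Type*} [AddCommGroup W] [Module R W] (D : PlaneFrame χ m)
    (ω : LinearMap.BilinForm R (P × W)) :
    Isometric (formPerp ω (psiForm R m)) (formPerp χ (D.hat ω)) := by
  -- Exchange the summand `P` with its copy `emb P` inside `R²ᵐ`, keeping the complement of `emb P`
  -- fixed.
  let e : ((P × W) × (Fin (2 * m) → R)) ≃ₗ[R] P × (W × (Fin (2 * m) → R)) :=
    { toFun := fun z => (D.ret z.2, (z.1.2, z.2 - D.emb (D.ret z.2) + D.emb z.1.1))
      invFun := fun z => ((D.ret z.2.2, z.2.1), z.2.2 - D.emb (D.ret z.2.2) + D.emb z.1)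
      left_inv := fun z => by simp
      right_inv := fun z => by simp
      map_add' := fun z w => by
        refine Prod.ext ?_ (Prod.ext ?_ ?_)
        · simp
        · simp
        · simp only [Prod.fst_add, Prod.snd_add, map_add]
          abel
      map_smul' := fun c z => by
        refine Prod.ext ?_ (Prod.ext ?_ ?_)
        · simp
        · simp
        · simp only [Prod.smul_fst, Prod.smul_snd, map_smul, RingHom.id_apply]
          module }
  have he : ∀ z, e z = (D.ret z.2, (z.1.2, z.2 - D.emb (D.ret z.2) + D.emb z.1.1)) := fun _ => rfl
  refine ⟨e, fun z w => ?_⟩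
  simp only [he, formPerp_apply, hat_apply, map_add, map_sub, ret_emb, sub_self, zero_add,
    LinearMap.add_apply, LinearMap.sub_apply, psiForm_emb, psiForm_emb_right]
  ring

/-- The Pfaffian of a form on `P ⊕ R²ⁿ` relative to `χ`. -/
noncomputable def relPf (D : PlaneFrame χ m) (n : ℕ)
    (ω : LinearMap.BilinForm R (P × (Fin (2 * n) → R))) : R :=
  pf (n + m) (gram (D.hat ω) (((Pi.basisFun R (Fin (2 * n))).prod
    (Pi.basisFun R (Fin (2 * m)))).reindex
      (finSumFinEquiv.trans (finCongr (Nat.mul_add 2 n m).symm))))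

/-- Extend `φ` by the identity on the complement of `P` in `R²ᵐ`. The extension `Φ` pulls `ω̂` back
to the hat of the pulled-back form and has the same determinant as `φ`, so the free case applies. -/
theorem relPf_comp [Module.Finite R P] [Module.Projective R P] (D : PlaneFrame χ m) (n : ℕ)
    (ω : LinearMap.BilinForm R (P × (Fin (2 * n) → R))) (hω : ∀ x, ω x x = 0)
    (φ : Module.End R (P × (Fin (2 * n) → R))) :
    D.relPf n (ω.compl₁₂ φ φ) = projDet φ * D.relPf n ω := by
  let F : ((Fin (2 * n) → R) × (Fin (2 * m) → R)) →ₗ[R] P × (Fin (2 * n) → R) :=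
    (D.ret ∘ₗ LinearMap.snd R _ _).prod (LinearMap.fst R _ _)
  let G : (P × (Fin (2 * n) → R)) →ₗ[R] (Fin (2 * n) → R) × (Fin (2 * m) → R) :=
    (LinearMap.snd R _ _).prod (D.emb ∘ₗ LinearMap.fst R _ _)
  have hFG : ∀ x, F (G x) = x := fun x => by simp [F, G]
  let Φ : Module.End R ((Fin (2 * n) → R) × (Fin (2 * m) → R)) := 1 + G ∘ₗ (φ - 1) ∘ₗ F
  have hdet : projDet φ = LinearMap.det Φ := by
    rw [← projDet_eq_det (((Pi.basisFun R (Fin (2 * n))).prod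
      (Pi.basisFun R (Fin (2 * m)))).reindex
      (finSumFinEquiv.trans (finCongr (Nat.mul_add 2 n m).symm)))]
    symm
    refine projDet_eq_of_sub_one G ((φ - 1) ∘ₗ F) (by simp [Φ]) ?_
    refine LinearMap.ext fun x => ?_
    simp [hFG]
  rw [hdet, relPf, relPf, ← pf_gram_comp _ (D.hat_self ω hω)]
  congr 1
  ext i j
  simp only [gram, Matrix.of_apply, Function.comp_apply]
  generalize (((Pi.basisFun R (Fin (2 * n))).prod (Pi.basisFun R (Fin (2 * m)))).reindex
      (finSumFinEquiv.trans (finCongr (Nat.mul_add 2 n m).symm))) i = u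
  generalize (((Pi.basisFun R (Fin (2 * n))).prod (Pi.basisFun R (Fin (2 * m)))).reindex
      (finSumFinEquiv.trans (finCongr (Nat.mul_add 2 n m).symm))) j = v
  have hF : ∀ u, (D.ret (Φ u).2, (Φ u).1) = φ (D.ret u.2, u.1) := by
    intro u
    change F (Φ u) = φ (F u)
    simp [Φ, hFG]
  -- `Φ` changes the component in `R²ᵐ` only along `emb P`, so `ψ_{2m} - χ(ret, ret)`, the form on
  -- the complement, is unaffected.
  have hP : ∀ u, ∃ p, (Φ u).2 = u.2 + D.emb p := fun u => ⟨_, rfl⟩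
  obtain ⟨p, hp⟩ := hP u
  obtain ⟨q, hq⟩ := hP v
  rw [hat_apply, hat_apply, hF, hF, hp, hq]
  simp only [LinearMap.compl₁₂_apply, map_add, LinearMap.add_apply, ret_emb, psiForm_emb,
    psiForm_emb_right]
  ring

end PlaneFrame

/-! ### Computation of relative Pfaffians and Vaserstein's form -/

theorem pf_row_zero' {R : Type*} [CommRing R] {k : ℕ} (hk : 0 < 2 * k)
    (X Y Z : Matrix (Fin (2 * k)) (Fin (2 * k)) R) (a b : R)
    (hX : ∀ i j, i ≠ ⟨0, hk⟩ → j ≠ ⟨0, hk⟩ → X i j = Z i j)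
    (hY : ∀ i j, i ≠ ⟨0, hk⟩ → j ≠ ⟨0, hk⟩ → Y i j = Z i j)
    (h : ∀ j, Z ⟨0, hk⟩ j = a * X ⟨0, hk⟩ j + b * Y ⟨0, hk⟩ j) :
    pf k Z = a * pf k X + b * pf k Y := by
  obtain ⟨n, rfl⟩ : ∃ n, k = n + 1 := ⟨k - 1, by omega⟩
  exact pf_row_zero X Y Z a b hX hY h

namespace PlaneFrame

variable {R : Type*} [CommRing R] {P : Type*} [AddCommGroup P] [Module R P]
  {χ : LinearMap.BilinForm R P} {m : ℕ}

/-- Values of `χ` generate the unit ideal, so identities may be checked after inverting one of them.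
-/
theorem eq_of_forall_localization (D : PlaneFrame χ m) (a b : R)
    (h : ∀ (u v : P), algebraMap R (Localization.Away (χ u v)) a =
      algebraMap R (Localization.Away (χ u v)) b) : a = b := by
  let J : Ideal R := LinearMap.ker (LinearMap.toSpanSingleton R R (a - b))
  have hJ : J.radical = ⊤ := by
    rw [Ideal.eq_top_iff_one, ← D.sum_eq]
    refine Ideal.sum_mem _ fun i _ => ?_
    have h1 := h (D.x i) (D.y i)
    rw [← sub_eq_zero, ← map_sub,
      IsLocalization.map_eq_zero_iff (Submonoid.powers (χ (D.x i) (D.y i)))] at h1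
    obtain ⟨⟨_, k, rfl⟩, hk⟩ := h1
    exact ⟨k, by simpa [J] using hk⟩
  rw [Ideal.radical_eq_top, Ideal.eq_top_iff_one] at hJ
  rw [← sub_eq_zero]
  simpa [J] using hJ

/-- The Gram matrix of `χ` pulled back to `R²ᵐ`. -/
def pullGram (D : PlaneFrame χ m) : Matrix (Fin (2 * m)) (Fin (2 * m)) R :=
  Matrix.of fun i j => χ (D.ret (Pi.single i 1)) (D.ret (Pi.single j 1))

/-- `E = 1 + c a l` with `a = emb u` and `l = χ(ret ·, v)` differs from the identity by a map of
rank one. In `Eᵗ ψ E` the quadratic term vanishes because `a` is isotropic, and the linear term is a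
multiple of the pulled-back form by Plücker. -/
theorem map_pullGram_congr (D : PlaneFrame χ m) {S : Type*} [CommRing S] (f : R →+* S) (u v : P)
    (c : S) : ∃ E : Matrix (Fin (2 * m)) (Fin (2 * m)) S, E.det = 1 + c * f (χ u v) ∧
      E.transpose * psi S m * E = psi S m + (c * f (χ u v)) • D.pullGram.map f := by
  let a : Matrix (Fin (2 * m)) Unit R := Matrix.of fun i _ => D.emb u i
  let l : Matrix Unit (Fin (2 * m)) R := Matrix.of fun _ j => χ (D.ret (Pi.single j 1)) v
  have hψ : (psi R m).map f = psi S m := by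
    ext i j
    simp only [psi, Matrix.map_apply, Matrix.of_apply]
    split_ifs <;> simp
  have h1 : ∀ w : Fin (2 * m) → R, w = ∑ i, w i • Pi.single i (1 : R) := fun w => by
    ext k
    simp [Pi.single_apply]
  have h2 : psi R m * a = -Matrix.of fun i _ => χ u (D.ret (Pi.single i 1)) := by
    ext i k
    rw [Matrix.neg_apply, Matrix.of_apply, ← psiForm_emb, ← psiForm_neg, psiForm,
      Matrix.toLinearMap₂'_apply', single_one_dotProduct]
    rfl
  have h3 : a.transpose * psi R m = Matrix.of fun _ j => χ u (D.ret (Pi.single j 1)) := by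
    have := congrArg Matrix.transpose h2
    rw [Matrix.transpose_mul, psi_transpose, Matrix.mul_neg, Matrix.transpose_neg] at this
    rw [neg_inj.1 this]
    rfl
  have h4 : l * a = Matrix.of fun _ _ => χ u v := by
    ext i j
    have : χ u v = χ (D.ret (D.emb u)) v := by simp
    rw [this, h1 (D.emb u)]
    simp [Matrix.mul_apply, l, a, mul_comm]
  have h5 : l.transpose * (a.transpose * psi R m) + psi R m * a * l = χ u v • D.pullGram := by
    rw [h2, h3]
    ext i j
    simp only [Matrix.add_apply, Matrix.mul_apply, Matrix.smul_apply, Matrix.neg_apply,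
      Matrix.transpose_apply, Matrix.of_apply, l, pullGram, Finset.univ_unique,
      Finset.sum_singleton, smul_eq_mul]
    have := D.plucker₄ (D.ret (Pi.single i 1)) u v (D.ret (Pi.single j 1))
    rw [D.neg (D.ret (Pi.single i 1)) v, D.neg (D.ret (Pi.single i 1)) u,
      D.neg (D.ret (Pi.single j 1)) v] at *
    linear_combination -this
  have h6 : a.transpose * psi R m * a = 0 := by
    rw [h3]
    ext i j
    have : (0 : R) = χ u (D.ret (D.emb u)) := by simp [D.alt]
    rw [Matrix.zero_apply, this, h1 (D.emb u)]
    simp [Matrix.mul_apply, a, mul_comm]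
  refine ⟨1 + c • (a * l).map f, ?_, ?_⟩
  · rw [Matrix.map_mul, ← Matrix.smul_mul, Matrix.det_one_add_mul_comm]
    rw [Matrix.mul_smul, ← Matrix.map_mul, h4]
    simp
  · have e : (1 + c • (a * l).map f).transpose * psi S m * (1 + c • (a * l).map f) =
        psi S m + c • (l.transpose * (a.transpose * psi R m) + psi R m * a * l).map f +
          (c * c) • (l.transpose * (a.transpose * psi R m * a) * l).map f := by
      rw [← hψ]
      simp only [Matrix.map_add f f.map_add, Matrix.map_mul, Matrix.transpose_add,
        Matrix.transpose_one, Matrix.transpose_smul, Matrix.transpose_map, Matrix.transpose_mul,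
        Matrix.add_mul, Matrix.mul_add, Matrix.one_mul, Matrix.mul_one, Matrix.smul_mul,
        Matrix.mul_smul, smul_add, smul_smul, Matrix.mul_assoc]
      abel
    rw [e, h5, h6]
    simp only [Matrix.mul_zero, Matrix.zero_mul]
    ext i j
    simp [mul_assoc]

/-- The matrix is that of `ψ_{2m}` with `χ` rescaled by `u` on its summand. Where `χ(x,y)` is
invertible, taking `c = (u - 1)/χ(x,y)` in `map_pullGram_congr` makes it congruent to `ψ_{2m}` by a
matrix of determinant `u`. -/
theorem pf_psi_add_smul_pullGram (D : PlaneFrame χ m) (u : R) :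
    pf m (psi R m + (u - 1) • D.pullGram) = u := by
  refine D.eq_of_forall_localization _ _ fun x y => ?_
  let f := algebraMap R (Localization.Away (χ x y))
  have hs : IsUnit (f (χ x y)) := IsLocalization.Away.algebraMap_isUnit _
  obtain ⟨s, hs⟩ := hs
  obtain ⟨E, hE, h⟩ := D.map_pullGram_congr f x y (f (u - 1) * ((s⁻¹ : _ˣ) : _))
  have hc : f (u - 1) * ((s⁻¹ : _ˣ) : _) * f (χ x y) = f (u - 1) := by
    rw [← hs, mul_assoc, Units.inv_mul, mul_one]
  rw [hc] at h hE
  have h' := pf_congr (psi _ m) E (psi_transpose m) (psi_diag m)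
  rw [h, hE, pf_psi] at h'
  change f _ = f _
  rw [← pf_map]
  have e : (psi R m + (u - 1) • D.pullGram).map f =
      psi _ m + f (u - 1) • D.pullGram.map f := by
    ext i j
    simp only [psi, Matrix.map_apply, Matrix.of_apply, Matrix.add_apply, Matrix.smul_apply,
      map_add, smul_eq_mul, map_mul]
    congr 1
    split_ifs <;> simp
  rw [e, h']
  simp

theorem relPf_formPerp (D : PlaneFrame χ m) (n : ℕ) (u : R)
    (B : LinearMap.BilinForm R (Fin (2 * n) → R)) :
    D.relPf n (formPerp (u • χ) B) = u * pf n (gram B (Pi.basisFun R (Fin (2 * n)))) := by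
  have e : gram (D.hat (formPerp (u • χ) B)) (((Pi.basisFun R (Fin (2 * n))).prod
      (Pi.basisFun R (Fin (2 * m)))).reindex
      (finSumFinEquiv.trans (finCongr (Nat.mul_add 2 n m).symm))) =
      perp (gram B (Pi.basisFun R (Fin (2 * n)))) (psi R m + (u - 1) • D.pullGram) := by
    ext i j
    obtain ⟨i, rfl⟩ := (finSumFinEquiv.trans (finCongr (Nat.mul_add 2 n m).symm)).surjective i
    obtain ⟨j, rfl⟩ := (finSumFinEquiv.trans (finCongr (Nat.mul_add 2 n m).symm)).surjective j
    rw [perp_apply, gram, Matrix.of_apply, Module.Basis.reindex_apply, Module.Basis.reindex_apply,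
      Equiv.symm_apply_apply, Equiv.symm_apply_apply, hat_apply]
    rcases i with i | i <;> rcases j with j | j
    · simp [gram]
    · simp
    · simp
    · simp [pullGram, psiForm, Matrix.toLinearMap₂'_apply']
      ring
  rw [relPf, e, pf_perp, pf_psi_add_smul_pullGram, mul_comm]

theorem relPf_formPerp_psiForm (D : PlaneFrame χ m) (n : ℕ) (u : R) :
    D.relPf n (formPerp (u • χ) (psiForm R n)) = u := by
  rw [relPf_formPerp, psiForm, gram_toLinearMap₂', pf_psi, mul_one]

/-- The form on `P ⊕ R²` that is `u χ` on `P`, pairs `p ∈ P` with the two basis vectors to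
`χ(σ, p)` and `-χ(α, p)`, and pairs the two basis vectors to `b`. -/
def vasersteinForm (χ : LinearMap.BilinForm R P) (u b : R) (σ α : P) :
    LinearMap.BilinForm R (P × (Fin (2 * 1) → R)) :=
  LinearMap.mk₂ R (fun x y => u * χ x.1 y.1 + (χ σ x.1 * y.2 0 - χ σ y.1 * x.2 0) -
      (χ α x.1 * y.2 1 - χ α y.1 * x.2 1) + b * (x.2 0 * y.2 1 - x.2 1 * y.2 0))
    (fun x x' y => by simp; ring) (fun c x y => by simp; ring)
    (fun x y y' => by simp; ring) (fun c x y => by simp; ring)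

theorem vasersteinForm_apply (u b : R) (σ α : P) (x y : P × (Fin (2 * 1) → R)) :
    vasersteinForm χ u b σ α x y = u * χ x.1 y.1 + (χ σ x.1 * y.2 0 - χ σ y.1 * x.2 0) -
      (χ α x.1 * y.2 1 - χ α y.1 * x.2 1) + b * (x.2 0 * y.2 1 - x.2 1 * y.2 0) := rfl

theorem vasersteinForm_self (D : PlaneFrame χ m) (u b : R) (σ α : P) (x : P × (Fin (2 * 1) → R)) :
    vasersteinForm χ u b σ α x x = 0 := by
  rw [vasersteinForm_apply, D.alt]
  ring

/-- For `b = 1` the two basis vectors span a hyperbolic plane. A shear makes `P` orthogonal to it,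
and by Plücker the form left on `P` is `(u + χ(σ,α)) χ`. -/
theorem relPf_vasersteinForm_one [Module.Finite R P] [Module.Projective R P]
    (D : PlaneFrame χ m) (u : R) (σ α : P) :
    D.relPf 1 (vasersteinForm χ u 1 σ α) = u + χ σ α := by
  let A : (R × R) →ₗ[R] P × (Fin (2 * 1) → R) :=
    LinearMap.inr R P _ ∘ₗ (LinearMap.pi ![LinearMap.fst R R R, LinearMap.snd R R R])
  let B : (P × (Fin (2 * 1) → R)) →ₗ[R] R × R := ((χ α).prod (χ σ)) ∘ₗ LinearMap.fst R P _
  have hBA : ∀ w, B (A w) = 0 := fun w => by simp [A, B]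
  have h := D.relPf_comp 1 (vasersteinForm χ u 1 σ α) (D.vasersteinForm_self u 1 σ α)
    (shear A B hBA : (P × (Fin (2 * 1) → R)) →ₗ[R] P × (Fin (2 * 1) → R))
  rw [mem_SL.1 (shear_mem_SL A B hBA), one_mul] at h
  rw [← h, ← D.relPf_formPerp_psiForm 1 (u + χ σ α)]
  congr 1
  refine LinearMap.ext₂ fun x y => ?_
  have e : ∀ x, shear A B hBA x = (x.1, ![x.2 0 + χ α x.1, x.2 1 + χ σ x.1]) := by
    intro x
    refine Prod.ext (by simp [A, B]) ?_
    ext i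
    fin_cases i <;> simp [A, B]
  simp only [LinearMap.compl₁₂_apply, LinearEquiv.coe_coe, e, vasersteinForm_apply, formPerp_apply,
    psiForm_one, LinearMap.smul_apply, smul_eq_mul, Matrix.cons_val_zero, Matrix.cons_val_one]
  have h1 := D.plucker₄ σ x.1 y.1 α
  rw [D.neg α y.1, D.neg σ y.1, D.neg α x.1] at h1
  linear_combination -h1

theorem relPf_vasersteinForm [Module.Finite R P] [Module.Projective R P]
    (D : PlaneFrame χ m) (u b : R) (σ α : P) :
    D.relPf 1 (vasersteinForm χ u b σ α) = u * b + χ σ α := by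
  have h1 := D.relPf_vasersteinForm_one u σ α
  have h2 := D.relPf_vasersteinForm_one u 0 α
  rw [map_zero, LinearMap.zero_apply, add_zero] at h2
  -- The parameters `(σ, b)` enter only the row and column of the first basis vector, linearly, and
  -- `(σ, b) = (σ, 1) + (b - 1)(0, 1)`.
  have key : D.relPf 1 (vasersteinForm χ u b σ α) =
      1 * D.relPf 1 (vasersteinForm χ u 1 σ α) +
        (b - 1) * D.relPf 1 (vasersteinForm χ u 1 0 α) := by
    unfold relPf
    set bas := ((Pi.basisFun R (Fin (2 * 1))).prod (Pi.basisFun R (Fin (2 * m)))).reindex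
      (finSumFinEquiv.trans (finCongr (Nat.mul_add 2 1 m).symm)) with hbas
    have hk : 0 < 2 * (1 + m) := by omega
    have hb0 : bas ⟨0, hk⟩ = (Pi.single 0 1, 0) := by
      have : (⟨0, hk⟩ : Fin (2 * (1 + m))) =
        (finSumFinEquiv.trans (finCongr (Nat.mul_add 2 1 m).symm)) (Sum.inl 0) := rfl
      rw [this, hbas, Module.Basis.reindex_apply, Equiv.symm_apply_apply]
      ext i <;> simp
    have hbi : ∀ i, i ≠ ⟨0, hk⟩ → (bas i).1 0 = 0 := by
      intro i hi
      obtain ⟨i, rfl⟩ := (finSumFinEquiv.trans (finCongr (Nat.mul_add 2 1 m).symm)).surjective i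
      rw [hbas, Module.Basis.reindex_apply, Equiv.symm_apply_apply]
      rcases i with i | i
      · have : i ≠ 0 := fun h => hi (by rw [h]; rfl)
        simp [this.symm]
      · simp
    refine pf_row_zero' hk _ _ _ _ _ ?_ ?_ ?_
    · intro i j hi hj
      simp only [gram, Matrix.of_apply, hat_apply, vasersteinForm_apply, hbi i hi, hbi j hj]
      ring
    · intro i j hi hj
      simp only [gram, Matrix.of_apply, hat_apply, vasersteinForm_apply, hbi i hi, hbi j hj]
      ring
    · intro j
      simp only [gram, Matrix.of_apply, hat_apply, vasersteinForm_apply, hb0]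
      simp
      ring
  rw [key, h1, h2]
  ring

end PlaneFrame

/-! ### Prime avoidance and heights -/

section PrimeAvoidance

variable {R : Type*} [CommRing R]

/-- Prime avoidance: an element can be moved by an element of `S` off finitely many "prime"
submodules, none of which contains `S`. -/
theorem exists_add_notMem {M : Type*} [AddCommGroup M] [Module R M] (S : Submodule R M)
    (N : Ideal R → Submodule R M) (x : M) (T : Finset (Ideal R)) (hT : ∀ t ∈ T, t.IsPrime)
    (h1 : ∀ t ∈ T, ∀ r ∈ t, ∀ m : M, r • m ∈ N t)
    (h2 : ∀ t ∈ T, ∀ r ∉ t, ∀ m : M, r • m ∈ N t → m ∈ N t)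
    (h3 : ∀ t ∈ T, ∃ m ∈ S, m ∉ N t) : ∃ m ∈ S, ∀ t ∈ T, x + m ∉ N t := by
  induction hn : T.card generalizing T with
  | zero =>
    refine ⟨0, zero_mem _, fun t ht => ?_⟩
    rw [Finset.card_eq_zero] at hn
    simp [hn] at ht
  | succ n ih =>
    have hne : T.Nonempty := by
      rw [← Finset.card_pos]
      omega
    -- With `t₀` minimal, some `c ∉ t₀` lies in all the other primes; adding a multiple of `c`
    -- corrects the situation at `t₀` without disturbing them.
    obtain ⟨t₀, ht₀, hmin⟩ := T.exists_minimal hne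
    have hsub : T.erase t₀ ⊆ T := Finset.erase_subset _ _
    obtain ⟨m, hm, hmT⟩ := ih (T.erase t₀) (fun t ht => hT t (hsub ht))
      (fun t ht => h1 t (hsub ht)) (fun t ht => h2 t (hsub ht)) (fun t ht => h3 t (hsub ht))
      (by rw [Finset.card_erase_of_mem ht₀, hn]; rfl)
    by_cases hx : x + m ∈ N t₀
    · have hp := hT t₀ ht₀
      have hinf : ¬ (T.erase t₀).inf id ≤ t₀ := by
        rw [hp.inf_le']
        rintro ⟨t, ht, hle⟩
        rw [Finset.mem_erase] at ht
        exact ht.1 (le_antisymm hle (hmin ht.2 hle))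
      obtain ⟨c, hc, hc'⟩ := SetLike.not_le_iff_exists.1 hinf
      obtain ⟨m', hm', hm't⟩ := h3 t₀ ht₀
      refine ⟨m + c • m', add_mem hm (S.smul_mem c hm'), fun t ht hmem => ?_⟩
      rw [← add_assoc] at hmem
      by_cases htt : t = t₀
      · subst htt
        exact hm't (h2 t ht c hc' m' (((N t).add_mem_iff_right hx).1 hmem))
      · have ht' : t ∈ T.erase t₀ := Finset.mem_erase.2 ⟨htt, ht⟩
        have hct : c ∈ t := (Finset.inf_le (f := id) ht' : _ ≤ t) hc
        exact hmT t ht' (((N t).add_mem_iff_left (h1 t ht c hct m')).1 hmem)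
    · refine ⟨m, hm, fun t ht => ?_⟩
      by_cases htt : t = t₀
      · rwa [htt]
      · exact hmT t (Finset.mem_erase.2 ⟨htt, ht⟩)

/-- All primes in `V(J) ∩ D(a)` have height at least `j`. -/
def HeightOff (a : R) (J : Ideal R) (j : ℕ) : Prop :=
  ∀ q : Ideal R, q.IsPrime → J ≤ q → a ∉ q → (j : ℕ∞) ≤ q.height

theorem HeightOff.mono {a : R} {J J' : Ideal R} {j : ℕ} (h : HeightOff a J j) (hJ : J ≤ J') :
    HeightOff a J' j := fun q hq hle ha => h q hq (hJ.trans hle) ha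

/-- A prime over `J'` off `a` strictly contains a minimal prime of `J` off `a`, which gains one in
height. -/
theorem HeightOff.succ {a : R} {J J' : Ideal R} {j : ℕ} (h : HeightOff a J j) (hJ : J ≤ J')
    (h' : ∀ q ∈ J.minimalPrimes, a ∉ q → ¬ J' ≤ q) : HeightOff a J' (j + 1) := by
  intro q hq hle ha
  obtain ⟨q₀, hq₀, hle₀⟩ := Ideal.exists_minimalPrimes_le (hJ.trans hle)
  have ha₀ : a ∉ q₀ := fun h => ha (hle₀ h)
  have : q₀.IsPrime := hq₀.1.1
  have hlt : q₀ < q := lt_of_le_of_ne hle₀ fun e => h' q₀ hq₀ ha₀ (e ▸ hle)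
  have := Ideal.height_add_one_le_of_lt_of_isPrime hlt
  refine le_trans ?_ this
  push_cast
  gcongr
  exact h q₀ hq₀.1.1 hq₀.1.2 ha₀

/-- Once the height bound reaches the dimension, only minimal primes remain; over a Noetherian ring
they are finite in number, so avoidance applies to all of them. -/
theorem HeightOff.mem_minimalPrimes {a : R} {J : Ideal R} {d : ℕ} (hdim : ringKrullDim R ≤ d)
    (h : HeightOff a J d) {q : Ideal R} (hq : q.IsPrime) (hle : J ≤ q) (ha : a ∉ q) :
    q ∈ J.minimalPrimes := by
  obtain ⟨q₀, hq₀, hle₀⟩ := Ideal.exists_minimalPrimes_le hle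
  have hp₀ : q₀.IsPrime := hq₀.1.1
  rcases eq_or_lt_of_le hle₀ with e | hlt
  · rwa [← e]
  · exfalso
    have h1 := Ideal.height_add_one_le_of_lt_of_isPrime hlt
    have h2 := h q₀ hp₀ hq₀.1.2 fun h => ha (hle₀ h)
    have h3 : (q.height : WithBot ℕ∞) ≤ (d : ℕ∞) :=
      (Ideal.height_le_ringKrullDim_of_ne_top hq.ne_top).trans hdim
    have h4 : q.height ≤ d := by exact_mod_cast h3
    have h5 : ((d + 1 : ℕ) : ℕ∞) ≤ d := by
      refine le_trans ?_ (h1.trans h4)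
      push_cast
      gcongr
    rw [Nat.cast_le] at h5
    omega

theorem HeightOff.exists_add [IsNoetherianRing R] {a : R} {J : Ideal R} {j : ℕ} (h : HeightOff a J j) (x : R) :
    ∃ t, HeightOff a (J ⊔ Ideal.span {x + a * t}) (j + 1) := by
  classical
  let T : Finset (Ideal R) := (J.finite_minimalPrimes_of_isNoetherianRing R).toFinset.filter (a ∉ ·)
  have hT : ∀ t, t ∈ T ↔ t ∈ J.minimalPrimes ∧ a ∉ t := fun t => by simp [T]
  obtain ⟨m, hm, hmT⟩ := exists_add_notMem (Ideal.span {a}) (fun t => t) x T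
    (fun t ht => ((hT t).1 ht).1.1.1) (fun t _ r hr m => t.mul_mem_right m hr)
    (fun t ht r hr m hm => (((hT t).1 ht).1.1.1.mem_or_mem hm).resolve_left hr)
    (fun t ht => ⟨a, Ideal.mem_span_singleton_self a, ((hT t).1 ht).2⟩)
  obtain ⟨t, rfl⟩ := Ideal.mem_span_singleton.1 hm
  refine ⟨t, h.succ le_sup_left fun q hq ha hle => hmT q ((hT q).2 ⟨hq, ha⟩) ?_⟩
  exact hle (le_sup_right (a := J) (Ideal.mem_span_singleton_self (x + a * t)))

end PrimeAvoidance

/-! ### Stable range over a ring of dimension at most 4 -/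

namespace PlaneFrame

variable {R : Type*} [CommRing R] {P : Type*} [AddCommGroup P] [Module R P]
  {χ : LinearMap.BilinForm R P} {m : ℕ}

/-- The elements of `P` that vanish modulo `q`. -/
def vanish (χ : LinearMap.BilinForm R P) (q : Ideal R) : Submodule R P where
  carrier := {z | ∀ y, χ z y ∈ q}
  add_mem' hz hw y := by
    rw [map_add, LinearMap.add_apply]
    exact q.add_mem (hz y) (hw y)
  zero_mem' y := by simp
  smul_mem' c z hz y := by
    rw [map_smul, LinearMap.smul_apply]
    exact q.mul_mem_left c (hz y)

theorem mem_vanish {q : Ideal R} {z : P} : z ∈ vanish χ q ↔ ∀ y, χ z y ∈ q := Iff.rfl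

theorem exists_notMem_vanish (D : PlaneFrame χ m) {q : Ideal R} (hq : q ≠ ⊤) :
    ∃ z, z ∉ vanish χ q := by
  by_contra! h
  refine hq (q.eq_top_iff_one.2 ?_)
  rw [← D.sum_eq]
  exact q.sum_mem fun i _ => h _ _

theorem smul_mem_vanish {q : Ideal R} {r : R} (hr : r ∈ q) (z : P) : r • z ∈ vanish χ q :=
  fun y => by
    rw [map_smul, LinearMap.smul_apply]
    exact q.mul_mem_right _ hr

theorem mem_vanish_of_smul_mem {q : Ideal R} (hq : q.IsPrime) {r : R} (hr : r ∉ q) {z : P}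
    (h : r • z ∈ vanish χ q) : z ∈ vanish χ q := fun y => by
  have := h y
  rw [map_smul, LinearMap.smul_apply] at this
  exact (hq.mem_or_mem this).resolve_left hr

/-- The vector `p` has to be made nonzero at all primes of `V(J) ∩ D(a)`, which have height `3` or
`4`. As `P` has no basis, an auxiliary vector `w`, nonzero at the minimal ones, gives the coordinate
`χ(w, ·)`. One correction makes this coordinate of `p` nonzero at the minimal primes and `p` nonzero
where `w` vanishes. The primes containing the coordinate then have height `4`, and a multiple of `a
w`, which leaves the coordinate unchanged, handles them. -/
theorem exists_add_forall_notMem_vanish [IsNoetherianRing R] (D : PlaneFrame χ m)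
    (hdim : ringKrullDim R ≤ 4) {a : R} {J : Ideal R} (hJ : HeightOff a J 3) (p : P) :
    ∃ c : P, ∀ q : Ideal R, q.IsPrime → J ≤ q → a ∉ q → p + a • c ∉ vanish χ q := by
  classical
  have hfin : ∀ J : Ideal R, ∃ T : Finset (Ideal R), ∀ t, t ∈ T ↔ t ∈ J.minimalPrimes ∧ a ∉ t :=
    fun J => ⟨(J.finite_minimalPrimes_of_isNoetherianRing R).toFinset.filter (a ∉ ·),
      fun t => by simp⟩
  obtain ⟨T₀, hT₀⟩ := hfin J
  have hp₀ : ∀ t ∈ T₀, t.IsPrime := fun t ht => ((hT₀ t).1 ht).1.1.1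
  obtain ⟨w, -, hw⟩ := exists_add_notMem (⊤ : Submodule R P) (vanish χ) 0 T₀ hp₀
    (fun t _ r hr m => smul_mem_vanish hr m)
    (fun t ht r hr m hm => mem_vanish_of_smul_mem (hp₀ t ht) hr hm)
    (fun t ht => by simpa using D.exists_notMem_vanish (hp₀ t ht).ne_top)
  simp only [zero_add] at hw
  let Jw : Ideal R := J ⊔ LinearMap.range (χ w)
  have hJw : HeightOff a Jw 4 := hJ.succ le_sup_left fun q hq ha hle =>
    hw q ((hT₀ q).2 ⟨hq, ha⟩) fun y => hle (le_sup_right (a := J) (LinearMap.mem_range_self (χ w) y))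
  obtain ⟨T₁, hT₁⟩ := hfin Jw
  have hp₁ : ∀ t ∈ T₁, t.IsPrime := fun t ht => ((hT₁ t).1 ht).1.1.1
  -- Where `w` vanishes, the height is already maximal, so only finitely many such primes occur.
  have hT₁' : ∀ q : Ideal R, q.IsPrime → J ≤ q → a ∉ q → w ∈ vanish χ q → q ∈ T₁ := by
    intro q hq hle ha hwq
    refine (hT₁ q).2 ⟨hJw.mem_minimalPrimes hdim hq (sup_le hle ?_) ha, ha⟩
    rintro _ ⟨y, rfl⟩
    exact hwq y
  -- At primes of `T₀` the stronger requirement `χ(w, p) ∉ t` is imposed; at the remaining primes of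
  -- `T₁` only that `p` does not vanish.
  let K : Ideal R → Submodule R P := fun q => Submodule.comap (χ w) q
  obtain ⟨c₁, hc₁, hc₁T⟩ := exists_add_notMem (LinearMap.range (LinearMap.lsmul R P a))
    (fun t => if t ∈ T₀ then K t else vanish χ t) p (T₀ ∪ T₁)
    (fun t ht => (Finset.mem_union.1 ht).elim (hp₀ t) (hp₁ t))
    (fun t _ r hr m => by
      split_ifs
      · change χ w (r • m) ∈ t
        rw [map_smul]
        exact t.mul_mem_right _ hr
      · exact smul_mem_vanish hr m)
    (fun t ht r hr m hm => by
      have hp := (Finset.mem_union.1 ht).elim (hp₀ t) (hp₁ t)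
      split_ifs at hm ⊢
      · change χ w (r • m) ∈ t at hm
        rw [map_smul] at hm
        exact (hp.mem_or_mem hm).resolve_left hr
      · exact mem_vanish_of_smul_mem hp hr hm)
    (fun t ht => by
      have hp := (Finset.mem_union.1 ht).elim (hp₀ t) (hp₁ t)
      have ha := (Finset.mem_union.1 ht).elim (fun h => ((hT₀ t).1 h).2) (fun h => ((hT₁ t).1 h).2)
      split_ifs with h
      · have := hw t h
        rw [mem_vanish] at this
        push Not at this
        obtain ⟨y, hy⟩ := this
        refine ⟨a • y, ⟨y, rfl⟩, fun hmem => ?_⟩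
        change χ w (a • y) ∈ t at hmem
        rw [map_smul] at hmem
        exact (hp.mem_or_mem hmem).elim ha hy
      · obtain ⟨z, hz⟩ := D.exists_notMem_vanish hp.ne_top
        exact ⟨a • z, ⟨z, rfl⟩, fun hmem => hz (mem_vanish_of_smul_mem hp ha hmem)⟩)
  obtain ⟨c₁, rfl⟩ := hc₁
  simp only [LinearMap.lsmul_apply] at hc₁T
  set p₂ := p + a • c₁ with hp₂def
  have hp₂0 : ∀ t ∈ T₀, χ w p₂ ∉ t := fun t ht => by
    have := hc₁T t (Finset.mem_union_left _ ht)
    rwa [if_pos ht] at this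
  have hp₂1 : ∀ t ∈ T₁, p₂ ∉ vanish χ t := fun t ht => by
    have := hc₁T t (Finset.mem_union_right _ ht)
    rwa [if_neg] at this
    intro h0
    exact hw t h0 fun y => ((hT₁ t).1 ht).1.1.2
      (le_sup_right (a := J) (LinearMap.mem_range_self (χ w) y))
  let J₂ : Ideal R := J ⊔ Ideal.span {χ w p₂}
  have hJ₂ : HeightOff a J₂ 4 := hJ.succ le_sup_left fun q hq ha hle =>
    hp₂0 q ((hT₀ q).2 ⟨hq, ha⟩) (hle (le_sup_right (a := J) (Ideal.mem_span_singleton_self _)))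
  obtain ⟨T₂, hT₂⟩ := hfin J₂
  have hp₂ : ∀ t ∈ T₂, t.IsPrime := fun t ht => ((hT₂ t).1 ht).1.1.1
  obtain ⟨c₂, hc₂, hc₂T⟩ := exists_add_notMem (Submodule.span R {a • w}) (vanish χ) p₂
    (T₂.filter (w ∉ vanish χ ·)) (fun t ht => hp₂ t (Finset.mem_filter.1 ht).1)
    (fun t _ r hr m => smul_mem_vanish hr m)
    (fun t ht r hr m hm => mem_vanish_of_smul_mem (hp₂ t (Finset.mem_filter.1 ht).1) hr hm)
    (fun t ht => ⟨a • w, Submodule.mem_span_singleton_self _, fun hmem =>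
      (Finset.mem_filter.1 ht).2 (mem_vanish_of_smul_mem (hp₂ t (Finset.mem_filter.1 ht).1)
        ((hT₂ t).1 (Finset.mem_filter.1 ht).1).2 hmem)⟩)
  obtain ⟨c, rfl⟩ := Submodule.mem_span_singleton.1 hc₂
  refine ⟨c₁ + c • w, fun q hq hle ha hmem => ?_⟩
  have e : p + a • (c₁ + c • w) = p₂ + c • a • w := by
    rw [hp₂def, smul_add, smul_comm a c, add_assoc]
  rw [e] at hmem
  by_cases hwq : w ∈ vanish χ q
  · refine hp₂1 q (hT₁' q hq hle ha hwq) ?_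
    exact ((vanish χ q).add_mem_iff_left
      ((vanish χ q).smul_mem c ((vanish χ q).smul_mem a hwq))).1 hmem
  -- Pairing with `w` removes the multiple of `w`, so `q` contains `χ(w, p₂)` and lies in `T₂`.
  · have h1 : χ w p₂ ∈ q := by
      have := hmem w
      rw [D.neg w, map_add, map_smul, map_smul, D.alt, smul_zero, smul_zero, add_zero,
        neg_mem_iff] at this
      exact this
    refine hc₂T q (Finset.mem_filter.2 ⟨(hT₂ q).2 ⟨hJ₂.mem_minimalPrimes hdim hq
      (sup_le hle ?_) ha, ha⟩, hwq⟩) hmem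
    rwa [Ideal.span_singleton_le_iff_mem]

/-- **Bass' stable range theorem** for `P ⊕ Rᵏ`, `k ≥ 3`, over a ring of dimension at most `4`. -/
theorem exists_unimodular_add [IsNoetherianRing R] (D : PlaneFrame χ m)
    (hdim : ringKrullDim R ≤ 4) {k : ℕ} (hk : 3 ≤ k) (p : P) (x : Fin k → R) (a : R)
    (h : ∃ (y : P) (z : Fin k → R) (d : R), χ p y + ∑ i, x i * z i + a * d = 1) :
    ∃ (c : P) (t : Fin k → R) (y : P) (z : Fin k → R),
      χ (p + a • c) y + ∑ i, (x i + a * t i) * z i = 1 := by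
  classical
  -- Three free coordinates raise the height off `a` to `3`; the rank-two part takes care of the
  -- remaining primes.
  have h0 : HeightOff a (⊥ : Ideal R) 0 := fun q _ _ _ => by simp
  let i₀ : Fin k := ⟨0, by omega⟩
  let i₁ : Fin k := ⟨1, by omega⟩
  let i₂ : Fin k := ⟨2, by omega⟩
  obtain ⟨t₀, h0⟩ := h0.exists_add (x i₀)
  obtain ⟨t₁, h0⟩ := h0.exists_add (x i₁)
  obtain ⟨t₂, h0⟩ := h0.exists_add (x i₂)
  let t : Fin k → R := fun i => if i = i₀ then t₀ else if i = i₁ then t₁ else if i = i₂ then t₂ else 0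
  let J : Ideal R := Ideal.span (Set.range fun i => x i + a * t i)
  have hmem : ∀ i, x i + a * t i ∈ J := fun i => Ideal.subset_span ⟨i, rfl⟩
  have hJ : HeightOff a J 3 := by
    refine h0.mono (sup_le (sup_le (sup_le bot_le ?_) ?_) ?_) <;>
      rw [Ideal.span_singleton_le_iff_mem]
    · simpa [t] using hmem i₀
    · simpa [t, i₁, i₀] using hmem i₁
    · simpa [t, i₂, i₁, i₀] using hmem i₂
  obtain ⟨c, hc⟩ := D.exists_add_forall_notMem_vanish hdim hJ p
  have htop : LinearMap.range (χ (p + a • c)) ⊔ J = ⊤ := by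
    by_contra hne
    obtain ⟨q, hq, hle⟩ := Ideal.exists_le_maximal _ hne
    -- At a prime containing `a` the corrections are invisible and the original unimodularity
    -- relation applies.
    by_cases ha : a ∈ q
    · obtain ⟨y, z, d, h⟩ := h
      refine hq.ne_top (q.eq_top_iff_one.2 ?_)
      rw [← h]
      refine q.add_mem (q.add_mem ?_ (q.sum_mem fun i _ => q.mul_mem_right _ ?_))
        (q.mul_mem_right _ ha)
      · have h1 : χ (p + a • c) y ∈ q := hle (le_sup_left (b := J) (LinearMap.mem_range_self _ y))
        rw [map_add, LinearMap.add_apply, map_smul, LinearMap.smul_apply] at h1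
        exact (q.add_mem_iff_left (q.mul_mem_right _ ha)).1 h1
      · have h1 : x i + a * t i ∈ q := hle (le_sup_right (b := J) (hmem i))
        exact (q.add_mem_iff_left (q.mul_mem_right _ ha)).1 h1
    · exact hc q hq.isPrime (le_sup_right.trans hle) ha fun y =>
        hle (le_sup_left (b := J) (LinearMap.mem_range_self _ y))
  obtain ⟨_, ⟨y, rfl⟩, s, hs, h1⟩ := Submodule.mem_sup.1 ((Ideal.eq_top_iff_one _).1 htop)
  obtain ⟨z, hz⟩ := Ideal.mem_span_range_iff_exists_fun.1 hs
  refine ⟨c, t, y, z, ?_⟩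
  rw [← h1, ← hz]
  congr 1
  exact Finset.sum_congr rfl fun i _ => mul_comm _ _

end PlaneFrame

/-! ### Perfect forms -/

section Perfect

variable {R : Type*} [CommRing R]
variable {V W : Type*} [AddCommGroup V] [Module R V] [AddCommGroup W] [Module R W]

/-- Every linear functional is represented by the form. -/
def IsPerfect (ω : LinearMap.BilinForm R V) : Prop :=
  ∀ f : V →ₗ[R] R, ∃ u, ∀ v, ω u v = f v

theorem IsPerfect.formPerp {α : LinearMap.BilinForm R V} {β : LinearMap.BilinForm R W}
    (hα : IsPerfect α) (hβ : IsPerfect β) : IsPerfect (formPerp α β) := by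
  intro f
  obtain ⟨u, hu⟩ := hα (f ∘ₗ LinearMap.inl R V W)
  obtain ⟨w, hw⟩ := hβ (f ∘ₗ LinearMap.inr R V W)
  refine ⟨(u, w), fun v => ?_⟩
  rw [formPerp_apply, hu, hw, LinearMap.comp_apply, LinearMap.comp_apply, ← map_add]
  simp

theorem isPerfect_toLinearMap₂' {n : ℕ} {M : Matrix (Fin n) (Fin n) R} (hM : IsUnit M) :
    IsPerfect (Matrix.toLinearMap₂' R M) := by
  intro f
  obtain ⟨N, hN⟩ := hM.exists_left_inv
  refine ⟨Matrix.vecMul (fun i => f (Pi.single i 1)) N, fun v => ?_⟩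
  rw [Matrix.toLinearMap₂'_apply', Matrix.dotProduct_mulVec, Matrix.vecMul_vecMul, hN,
    Matrix.vecMul_one]
  have h : v = ∑ i, v i • Pi.single i (1 : R) := by
    ext k
    simp [Pi.single_apply]
  conv_rhs => rw [h]
  simp [dotProduct, mul_comm]

theorem isPerfect_psiForm (n : ℕ) : IsPerfect (psiForm R n) :=
  isPerfect_toLinearMap₂' (isUnit_of_pf_eq_one _ (psi_transpose n) (psi_diag n) (pf_psi n))

theorem IsPerfect.of_isometric {α : LinearMap.BilinForm R V} {β : LinearMap.BilinForm R W}
    (h : Isometric α β) (hα : IsPerfect α) : IsPerfect β := by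
  obtain ⟨e, he⟩ := h
  intro f
  obtain ⟨u, hu⟩ := hα (f ∘ₗ (e : V →ₗ[R] W))
  refine ⟨e u, fun v => ?_⟩
  have := he u (e.symm v)
  rw [e.apply_symm_apply, hu] at this
  simpa using this

theorem IsPerfect.of_hyp {α : LinearMap.BilinForm R V} (h : IsPerfect (hyp α)) : IsPerfect α := by
  intro f
  obtain ⟨u, hu⟩ := h (f ∘ₗ LinearMap.fst R V R ∘ₗ LinearMap.fst R _ R)
  refine ⟨u.1.1, fun v => ?_⟩
  simpa using hu ((v, 0), 0)

theorem neg_of_self_eq_zero {ω : LinearMap.BilinForm R V} (h : ∀ x, ω x x = 0) (x y : V) :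
    ω x y = - ω y x := by
  have h := h (x + y)
  simp only [map_add, LinearMap.add_apply, ‹∀ x, ω x x = 0›, zero_add, add_zero] at h
  exact eq_neg_of_add_eq_zero_right h

end Perfect

/-! ### Transvections, cancellation and splitting of hyperbolic planes -/

section Transvections

variable {R : Type*} [CommRing R] {V : Type*} [AddCommGroup V] [Module R V]

/-- If the restriction to `V` of a functional on `V ⊕ R` is unimodular, then the functional can be
moved to the projection. -/
theorem exists_mem_SL_coprod [Module.Finite R V] [Module.Projective R V] (f : V →ₗ[R] R) (v₀ : V)
    (h : f v₀ = 1) (a : (V × R) →ₗ[R] R) (ha : ∀ v, a (v, 0) = f v) :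
    ∃ φ ∈ SL R (V × R), a ∘ₗ (φ : (V × R) →ₗ[R] V × R) = LinearMap.snd R V R := by
  let c := a (0, 1)
  have ha' : ∀ v r, a (v, r) = f v + r * c := fun v r => by
    rw [← ha, ← smul_eq_mul, ← map_smul, ← map_add]
    simp
  -- Adding `r(1 - c) v₀` turns the coefficient `c` of the last coordinate into `1`; the second
  -- shear then clears `f`.
  let A : R →ₗ[R] V × R := LinearMap.inl R V R ∘ₗ LinearMap.toSpanSingleton R V ((1 - c) • v₀)
  let S₂ := shear A (LinearMap.snd R V R) (fun w => by simp [A])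
  let S₃ := shear (LinearMap.inr R V R) (-(f ∘ₗ LinearMap.fst R V R)) (fun w => by simp)
  refine ⟨S₂ * S₃, mul_mem (shear_mem_SL _ _ _) (shear_mem_SL _ _ _), ?_⟩
  refine LinearMap.ext fun z => ?_
  obtain ⟨v, r⟩ := z
  have h3 : S₃ (v, r) = (v, r - f v) := by
    simp [S₃, sub_eq_add_neg]
  have h2 : ∀ v r, S₂ (v, r) = (v + (r * (1 - c)) • v₀, r) := fun v r => by
    simp [S₂, A, smul_smul]
  change a (S₂ (S₃ (v, r))) = r
  rw [h3, h2, ha', map_add, map_smul, h, smul_eq_mul]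
  ring

/-- A symplectic transvection of `V ⊥ H` fixing the first vector of the hyperbolic plane `H`. -/
def transFst (ω : LinearMap.BilinForm R V) (hω : ∀ x, ω x x = 0) (q : V) (c : R) :
    ((V × R) × R) ≃ₗ[R] (V × R) × R where
  toFun z := ((z.1.1 + z.2 • q, z.1.2 + ω q z.1.1 + c * z.2), z.2)
  invFun z := ((z.1.1 - z.2 • q, z.1.2 - ω q z.1.1 - c * z.2), z.2)
  left_inv z := by
    refine Prod.ext (Prod.ext ?_ ?_) rfl
    · simp
    · simp [hω]
      ring
  right_inv z := by
    refine Prod.ext (Prod.ext ?_ ?_) rfl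
    · simp
    · simp [hω]
      ring
  map_add' z w := by
    refine Prod.ext (Prod.ext ?_ ?_) rfl
    · simp only [Prod.fst_add, Prod.snd_add]
      module
    · simp
      ring
  map_smul' r z := by
    refine Prod.ext (Prod.ext ?_ ?_) rfl
    · simp only [Prod.smul_fst, Prod.smul_snd, RingHom.id_apply, smul_eq_mul]
      module
    · simp
      ring

/-- A symplectic transvection of `V ⊥ H` fixing the second vector of the hyperbolic plane `H`. -/
def transSnd (ω : LinearMap.BilinForm R V) (hω : ∀ x, ω x x = 0) (q : V) (c : R) :
    ((V × R) × R) ≃ₗ[R] (V × R) × R where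
  toFun z := ((z.1.1 + z.1.2 • q, z.1.2), z.2 - ω q z.1.1 + c * z.1.2)
  invFun z := ((z.1.1 - z.1.2 • q, z.1.2), z.2 + ω q z.1.1 - c * z.1.2)
  left_inv z := by
    refine Prod.ext (Prod.ext ?_ rfl) ?_
    · simp
    · simp [hω]
      ring
  right_inv z := by
    refine Prod.ext (Prod.ext ?_ rfl) ?_
    · simp
    · simp [hω]
      ring
  map_add' z w := by
    refine Prod.ext (Prod.ext ?_ rfl) ?_
    · simp only [Prod.fst_add, Prod.snd_add]
      module
    · simp
      ring
  map_smul' r z := by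
    refine Prod.ext (Prod.ext ?_ rfl) ?_
    · simp only [Prod.smul_fst, Prod.smul_snd, RingHom.id_apply, smul_eq_mul]
      module
    · simp
      ring

theorem transFst_apply (ω : LinearMap.BilinForm R V) (hω : ∀ x, ω x x = 0) (q : V) (c : R)
    (z : (V × R) × R) : transFst ω hω q c z =
      ((z.1.1 + z.2 • q, z.1.2 + ω q z.1.1 + c * z.2), z.2) := rfl

theorem transSnd_apply (ω : LinearMap.BilinForm R V) (hω : ∀ x, ω x x = 0) (q : V) (c : R)
    (z : (V × R) × R) : transSnd ω hω q c z =
      ((z.1.1 + z.1.2 • q, z.1.2), z.2 - ω q z.1.1 + c * z.1.2) := rfl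

theorem transFst_mem_Sp (ω : LinearMap.BilinForm R V) (hω : ∀ x, ω x x = 0) (q : V) (c : R) :
    transFst ω hω q c ∈ Sp (hyp ω) := by
  intro z w
  simp only [transFst_apply, hyp_apply, map_add, map_smul, LinearMap.add_apply,
    LinearMap.smul_apply, smul_eq_mul, hω]
  rw [neg_of_self_eq_zero hω z.1.1 q]
  ring

theorem transSnd_mem_Sp (ω : LinearMap.BilinForm R V) (hω : ∀ x, ω x x = 0) (q : V) (c : R) :
    transSnd ω hω q c ∈ Sp (hyp ω) := by
  intro z w
  simp only [transSnd_apply, hyp_apply, map_add, map_smul, LinearMap.add_apply,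
    LinearMap.smul_apply, smul_eq_mul, hω]
  rw [neg_of_self_eq_zero hω z.1.1 q]
  ring

/-- A vector `(v, x, y)` such that `(v + y q, x + y t)` is unimodular for suitable `q` and `t` can
be moved to the last basis vector by a symplectic automorphism. -/
theorem exists_mem_Sp_hyp (ω : LinearMap.BilinForm R V) (hω : ∀ x, ω x x = 0) (v : V) (x y : R)
    (h : ∃ (q : V) (t : R) (u : V) (r : R), ω u (v + y • q) + r * (x + y * t) = 1) :
    ∃ σ ∈ Sp (hyp ω), σ ((v, x), y) = ((0, 0), 1) := by
  obtain ⟨q, t, u, r, h⟩ := h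
  let σ₁ := transFst ω hω q t
  set v₁ := v + y • q with hv₁
  set x₁ := x + ω q v + t * y with hx₁
  -- Chosen to make the last coordinate `1`. It changes by `(1 - y)(ω(u, v₁) - r ω(q, v) + r x₁)`;
  -- the term in `r q` cancels the `ω(q, v)` contained in `x₁`, leaving `1 - y`.
  let q' := (y - 1) • (u - r • q)
  let σ₂ := transSnd ω hω q' ((1 - y) * r)
  let v₂ := v₁ + x₁ • q'
  let σ₃ := transFst ω hω (-v₂) (-x₁)
  have e1 : σ₁ ((v, x), y) = ((v₁, x₁), y) := rfl
  have e2 : σ₂ ((v₁, x₁), y) = ((v₂, x₁), 1) := by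
    refine Prod.ext rfl ?_
    change y - ω q' v₁ + (1 - y) * r * x₁ = 1
    have h1 : ω q v₁ = ω q v := by simp [hv₁, hω]
    simp only [q', map_smul, map_sub, LinearMap.sub_apply, LinearMap.smul_apply, smul_eq_mul, h1]
    rw [hx₁]
    linear_combination (1 - y) * h
  have e3 : σ₃ ((v₂, x₁), 1) = ((0, 0), 1) := by
    refine Prod.ext (Prod.ext ?_ ?_) rfl
    · simp [σ₃, transFst_apply]
    · simp [σ₃, transFst_apply, hω]
  refine ⟨σ₃ * (σ₂ * σ₁), mul_mem (transFst_mem_Sp _ _ _ _) (mul_mem (transSnd_mem_Sp _ _ _ _)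
    (transFst_mem_Sp _ _ _ _)), ?_⟩
  change σ₃ (σ₂ (σ₁ ((v, x), y))) = _
  rw [e1, e2, e3]

/-- Cancellation of hyperbolic planes. -/
theorem Isometric.of_hyp {W : Type*} [AddCommGroup W] [Module R W] {α : LinearMap.BilinForm R W}
    {ω : LinearMap.BilinForm R V}
    (hω : ∀ z, (∃ z', hyp ω z' z = 1) → ∃ σ ∈ Sp (hyp ω), σ z = ((0, 0), 1))
    (h : Isometric (hyp α) (hyp ω)) : Isometric α ω := by
  obtain ⟨e, he⟩ := h
  obtain ⟨σ, hσ, hσe⟩ := hω (e ((0, 0), 1)) ⟨e ((0, 1), 0), by rw [he]; simp⟩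
  obtain ⟨ε, hε, hεe⟩ : ∃ ε : ((W × R) × R) ≃ₗ[R] (V × R) × R,
      (∀ x y, hyp ω (ε x) (ε y) = hyp α x y) ∧ ε ((0, 0), 1) = ((0, 0), 1) :=
    ⟨e.trans σ, fun x y => (hσ _ _).trans (he x y), hσe⟩
  -- An isometry fixing the last basis vector preserves its orthogonal complement, hence induces a
  -- map modulo that vector, from `W` to `V`.
  have h1 : ∀ w, (ε ((w, 0), 0)).1.2 = 0 := fun w => by
    have := hε ((w, 0), 0) ((0, 0), 1)
    rw [hεe] at this
    simpa using this
  have hεe' : ε.symm ((0, 0), 1) = ((0, 0), 1) := by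
    rw [LinearEquiv.symm_apply_eq, hεe]
  have h1' : ∀ v, (ε.symm ((v, 0), 0)).1.2 = 0 := fun v => by
    have := hε (ε.symm ((v, 0), 0)) ((0, 0), 1)
    rw [hεe, ε.apply_symm_apply] at this
    simpa using this.symm
  have h2 : ∀ (w : W) (y : R), (ε ((w, 0), y)).1.1 = (ε ((w, 0), 0)).1.1 := fun w y => by
    have e : (((w, 0), y) : (W × R) × R) = ((w, 0), 0) + y • ((0, 0), 1) := by simp
    rw [e, map_add, map_smul, hεe]
    simp
  have h2' : ∀ (v : V) (y : R), (ε.symm ((v, 0), y)).1.1 = (ε.symm ((v, 0), 0)).1.1 := fun v y => by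
    have e : (((v, 0), y) : (V × R) × R) = ((v, 0), 0) + y • ((0, 0), 1) := by simp
    rw [e, map_add, map_smul, hεe']
    simp
  have h3 : ∀ w, ε ((w, 0), 0) = (((ε ((w, 0), 0)).1.1, 0), (ε ((w, 0), 0)).2) := fun w =>
    Prod.ext (Prod.ext rfl (h1 w)) rfl
  have h3' : ∀ v, ε.symm ((v, 0), 0) =
      (((ε.symm ((v, 0), 0)).1.1, 0), (ε.symm ((v, 0), 0)).2) := fun v =>
    Prod.ext (Prod.ext rfl (h1' v)) rfl
  let f : W →ₗ[R] V := LinearMap.fst R V R ∘ₗ LinearMap.fst R _ R ∘ₗ (ε : _ →ₗ[R] _) ∘ₗ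
    LinearMap.inl R _ R ∘ₗ LinearMap.inl R W R
  let g : V →ₗ[R] W := LinearMap.fst R W R ∘ₗ LinearMap.fst R _ R ∘ₗ (ε.symm : _ →ₗ[R] _) ∘ₗ
    LinearMap.inl R _ R ∘ₗ LinearMap.inl R V R
  have hf : ∀ w, f w = (ε ((w, 0), 0)).1.1 := fun _ => rfl
  have hg : ∀ v, g v = (ε.symm ((v, 0), 0)).1.1 := fun _ => rfl
  refine ⟨LinearEquiv.ofLinearMap f g ?_ ?_, fun x y => ?_⟩
  · refine LinearMap.ext fun v => ?_
    rw [LinearMap.comp_apply, hf, hg, ← h2 _ (ε.symm ((v, 0), 0)).2, ← h3', ε.apply_symm_apply]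
    rfl
  · refine LinearMap.ext fun w => ?_
    rw [LinearMap.comp_apply, hg, hf, ← h2' _ (ε ((w, 0), 0)).2, ← h3, ε.symm_apply_apply]
    rfl
  · have := hε ((x, 0), 0) ((y, 0), 0)
    simp only [hyp_apply, h1] at this
    simpa [hf] using this

/-- If `SL(V ⊕ R)` acts transitively on `Um(V ⊕ R)`, then every non-degenerate alternating form on
`V ⊕ R²` splits off a hyperbolic plane with given last basis vector. -/
theorem UmTransitive.exists_hyp [Module.Finite R V] [Module.Projective R V]
    (h : UmTransitive R (V × R)) (ω : LinearMap.BilinForm R ((V × R) × R))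
    (hω : ∀ x, ω x x = 0) (hp : IsPerfect ω) :
    ∃ φ ∈ SL R ((V × R) × R), φ ((0, 0), 1) = ((0, 0), 1) ∧
      ∃ α : LinearMap.BilinForm R V, (∀ x, α x x = 0) ∧
        ∀ x y, ω (φ x) (φ y) = hyp α x y := by
  let e : (V × R) × R := ((0, 0), 1)
  let a : (V × R) →ₗ[R] R := ω.flip e ∘ₗ LinearMap.inl R (V × R) R
  have ha : a ∈ Um R (V × R) := by
    obtain ⟨u, hu⟩ := hp (LinearMap.snd R _ R)
    -- The component of `u` along `e` contributes nothing, because `ω(e, e) = 0`.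
    have h1 : a u.1 = 1 := by
      have h2 := hu e
      have h3 : u = (u.1, 0) + u.2 • e := by simp [e, Prod.mk_zero_zero]
      rw [h3, map_add, LinearMap.add_apply, map_smul, LinearMap.smul_apply, hω] at h2
      simpa [e, a] using h2
    exact fun r => ⟨r • u.1, by rw [map_smul, h1, smul_eq_mul, mul_one]⟩
  obtain ⟨τ, hτ, hτa⟩ := h a ha (LinearMap.snd R V R) fun r => ⟨(0, r), rfl⟩
  let φ₁ : ((V × R) × R) ≃ₗ[R] (V × R) × R := τ.prodCongr (LinearEquiv.refl R R)
  have hφ₁e : φ₁ e = e := by simp [φ₁, e, Prod.mk_zero_zero]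
  let ω₁ : LinearMap.BilinForm R ((V × R) × R) :=
    ω.compl₁₂ (φ₁ : ((V × R) × R) →ₗ[R] (V × R) × R) (φ₁ : ((V × R) × R) →ₗ[R] (V × R) × R)
  have hω₁ : ∀ x, ω₁ x x = 0 := fun x => hω _
  have h1 : ∀ x : V × R, ω₁ (x, 0) e = x.2 := fun x => by
    change ω (φ₁ (x, 0)) (φ₁ e) = x.2
    rw [hφ₁e]
    exact LinearMap.congr_fun hτa x
  let e₃ : (V × R) × R := ((0, 1), 0)
  let B : ((V × R) × R) →ₗ[R] R := ω₁.flip e₃ ∘ₗ LinearMap.inl R (V × R) R ∘ₗ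
    LinearMap.inl R V R ∘ₗ LinearMap.fst R V R ∘ₗ LinearMap.fst R (V × R) R
  -- After `φ₁`, `V` is orthogonal to `e` and `ω₁(e₃, e) = 1`. Adding `ω₁(v, e₃) e` to `v` makes it
  -- orthogonal to `e₃` as well.
  let ρ := shear (LinearMap.inr R (V × R) R) B (fun w => by simp [B, Prod.mk_zero_zero])
  have hρ : ∀ v x y, ρ ((v, x), y) = ((v, 0), ω₁ ((v, 0), 0) e₃) + x • e₃ + y • e := fun v x y => by
    simp [ρ, B, e₃, e, add_comm]
  have hρ' : ∀ v x y, ρ ((v, x), y) =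
      ((v, 0), 0) + ω₁ ((v, 0), 0) e₃ • e + x • e₃ + y • e := fun v x y => by
    rw [hρ]
    congr 2
    simp [e]
  refine ⟨φ₁ * ρ, mul_mem (prodCongr_mem_SL hτ) (shear_mem_SL _ _ _), ?_,
    ω₁.compl₁₂ (LinearMap.inl R _ R ∘ₗ LinearMap.inl R V R)
      (LinearMap.inl R _ R ∘ₗ LinearMap.inl R V R), fun x => hω₁ _, fun x y => ?_⟩
  · change φ₁ (ρ ((0, 0), 1)) = _
    have : ρ ((0, 0), 1) = e := by simp [ρ, B, e, Prod.mk_zero_zero]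
    rw [this, hφ₁e]
  · obtain ⟨⟨v, a⟩, b⟩ := x
    obtain ⟨⟨v', a'⟩, b'⟩ := y
    change ω₁ (ρ ((v, a), b)) (ρ ((v', a'), b')) = _
    rw [hρ', hρ']
    have h2 : ∀ v, ω₁ ((v, 0), 0) e = 0 := fun v => h1 (v, 0)
    have h3 : ω₁ e₃ e = 1 := h1 (0, 1)
    have h4 : ω₁ e e₃ = -1 := by rw [neg_of_self_eq_zero hω₁, h3]
    have h5 : ∀ v, ω₁ e ((v, 0), 0) = 0 := fun v => by rw [neg_of_self_eq_zero hω₁, h2, neg_zero]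
    have h6 : ∀ v, ω₁ e₃ ((v, 0), 0) = - ω₁ ((v, 0), 0) e₃ := fun v => neg_of_self_eq_zero hω₁ _ _
    simp only [map_add, map_smul, LinearMap.add_apply, LinearMap.smul_apply, smul_eq_mul, h2, h3,
      h4, h5, h6, hω₁, hyp_apply, LinearMap.compl₁₂_apply, LinearMap.comp_apply,
      LinearMap.inl_apply]
    ring

end Transvections

/-! ### Transitivity and cancellation in dimension at most 4 -/

namespace PlaneFrame

variable {R : Type*} [CommRing R] {P : Type*} [AddCommGroup P] [Module R P]
  {χ : LinearMap.BilinForm R P} {m : ℕ}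

theorem formPerp_psiForm_self (D : PlaneFrame χ m) (n : ℕ) (x : P × (Fin (2 * n) → R)) :
    formPerp χ (psiForm R n) x x = 0 := by
  rw [formPerp_apply, D.alt, psiForm_self, add_zero]

/-- Stable range lets a shear make the restriction to `P ⊕ Rᵏ` unimodular; `exists_mem_SL_coprod`
then finishes. -/
theorem umTransitive [IsNoetherianRing R] [Module.Finite R P] [Module.Projective R P]
    (D : PlaneFrame χ m) (hdim : ringKrullDim R ≤ 4) {k : ℕ} (hk : 3 ≤ k) :
    UmTransitive R ((P × (Fin k → R)) × R) := by
  refine umTransitive_of_forall (LinearMap.snd R _ R) fun a ha => ?_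
  let f : (P × (Fin k → R)) →ₗ[R] R := a ∘ₗ LinearMap.inl R _ R
  let c := a (0, 1)
  obtain ⟨σ, hσ⟩ := D.perfect (f ∘ₗ LinearMap.inl R P _)
  let x : Fin k → R := fun i => f (0, Pi.single i 1)
  have hf : ∀ y z, f (y, z) = χ σ y + ∑ i, x i * z i := by
    intro y z
    have h : z = ∑ i, z i • Pi.single i (1 : R) := by
      ext k
      simp [Pi.single_apply]
    have h1 : f (0, z) = ∑ i, x i * z i := by
      change (f ∘ₗ LinearMap.inr R P _) z = _
      conv_lhs => rw [h]
      simp [x, mul_comm]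
    rw [hσ, ← h1]
    change f (y, z) = f (y, 0) + f (0, z)
    rw [← map_add]
    simp
  have hac : ∀ v r, a (v, r) = f v + r * c := fun v r => by
    change _ = a (v, 0) + r * a (0, 1)
    rw [← smul_eq_mul, ← map_smul, ← map_add]
    simp
  obtain ⟨⟨⟨y, z⟩, d⟩, h1⟩ := ha 1
  rw [hac, hf] at h1
  obtain ⟨q, t, y', z', h2⟩ := D.exists_unimodular_add hdim hk σ x c
    ⟨y, z, d, by rw [mul_comm c]; exact h1⟩
  let g : (P × (Fin k → R)) →ₗ[R] R := (χ q).coprod (∑ i, t i • LinearMap.proj i)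
  have hg : ∀ y z, g (y, z) = χ q y + ∑ i, t i * z i := fun y z => by simp [g]
  let S := shear (LinearMap.inr R (P × (Fin k → R)) R) (g ∘ₗ LinearMap.fst R _ R)
    (fun w => by simp)
  obtain ⟨φ, hφ, h3⟩ := exists_mem_SL_coprod (f + c • g) (y', z') (by
    rw [LinearMap.add_apply, LinearMap.smul_apply, hf, hg, ← h2]
    simp only [map_add, map_smul, LinearMap.add_apply, LinearMap.smul_apply, smul_eq_mul, add_mul,
      Finset.sum_add_distrib, mul_add, Finset.mul_sum, mul_assoc]
    ring) (a ∘ₗ (S : _ →ₗ[R] _)) (fun v => by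
      have : S (v, 0) = (v, g v) := by simp [S]
      simp [this, hac, mul_comm])
  exact ⟨S * φ, mul_mem (shear_mem_SL _ _ _) hφ, h3⟩

/-- The coordinates of `R²ⁿ` and the first hyperbolic coordinate `x` give `2n + 1 ≥ 3` free
coordinates, enough for the stable range theorem relative to `y`. -/
theorem exists_mem_Sp_hyp [IsNoetherianRing R] (D : PlaneFrame χ m) (hdim : ringKrullDim R ≤ 4)
    {n : ℕ} (hn : 1 ≤ n) (z : ((P × (Fin (2 * n) → R)) × R) × R)
    (hz : ∃ z', hyp (formPerp χ (psiForm R n)) z' z = 1) :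
    ∃ σ ∈ Sp (hyp (formPerp χ (psiForm R n))), σ z = ((0, 0), 1) := by
  obtain ⟨⟨⟨p, w⟩, x⟩, y⟩ := z
  obtain ⟨⟨⟨⟨p', w'⟩, x'⟩, y'⟩, h⟩ := hz
  refine RankTwo.exists_mem_Sp_hyp _ (D.formPerp_psiForm_self n) _ _ _ ?_
  have hψ : ∀ w' w : Fin (2 * n) → R, psiForm R n w' w =
      ∑ i, w i * psiForm R n w' (Pi.single i 1) := by
    intro w' w
    have h : w = ∑ i, w i • Pi.single i (1 : R) := by
      ext k
      simp [Pi.single_apply]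
    conv_lhs => rw [h]
    simp
  simp only [hyp_apply, formPerp_apply] at h
  obtain ⟨q, t, u, s, h1⟩ := D.exists_unimodular_add hdim (k := 2 * n + 1) (by omega) p
    (Fin.snoc (α := fun _ => R) w x) y ⟨-p', Fin.snoc (α := fun _ => R)
      (fun i => psiForm R n w' (Pi.single i 1)) (-y'), x', by
      rw [Fin.sum_univ_castSucc]
      simp only [Fin.snoc_castSucc, Fin.snoc_last, map_neg]
      rw [← hψ, ← h, D.neg p p']
      ring⟩
  obtain ⟨w'', hw''⟩ := isPerfect_psiForm (R := R) n
    (∑ i : Fin (2 * n), s i.castSucc • LinearMap.proj i)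
  refine ⟨(q, fun i => t i.castSucc), t (Fin.last _), (-u, w''), s (Fin.last _), ?_⟩
  rw [Fin.sum_univ_castSucc] at h1
  simp only [Fin.snoc_castSucc, Fin.snoc_last] at h1
  rw [formPerp_apply, hw'', ← h1]
  simp only [Prod.fst_add, Prod.snd_add, Prod.smul_fst, Prod.smul_snd, map_neg,
    LinearMap.neg_apply, LinearMap.sum_apply, LinearMap.smul_apply, LinearMap.proj_apply,
    Pi.add_apply, Pi.smul_apply, smul_eq_mul]
  rw [D.neg (p + y • q) u]
  simp only [mul_comm]
  ring

/-- Cancellation of `ψ_{2N}` from forms stably isometric to `χ ⊥ ψ_2`. -/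
theorem isometric_of_formPerp_psiForm [IsNoetherianRing R] (D : PlaneFrame χ m)
    (hdim : ringKrullDim R ≤ 4) {V : Type*} [AddCommGroup V] [Module R V]
    (α : LinearMap.BilinForm R V) (N : ℕ)
    (h : Isometric (formPerp α (psiForm R N)) (formPerp χ (psiForm R (1 + N)))) :
    Isometric α (formPerp χ (psiForm R 1)) := by
  induction N with
  | zero =>
    refine Isometric.trans ?_ h
    refine ⟨LinearEquiv.ofLinearMap (LinearMap.inl R V _) (LinearMap.fst R V _) ?_ ?_, fun x y => ?_⟩
    · refine LinearMap.ext fun x => Prod.ext rfl ?_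
      ext i
      exact i.elim0
    · rfl
    · change formPerp α (psiForm R 0) (x, 0) (y, 0) = α x y
      simp
  | succ N ih =>
    refine ih (Isometric.of_hyp (D.exists_mem_Sp_hyp hdim (by omega)) ?_)
    exact ((isometric_hyp_formPerp_psiForm α N).trans h).trans
      (isometric_hyp_formPerp_psiForm χ (1 + N)).symm

end PlaneFrame

/-! ### Alternating matrices, their isometries and their classes -/

section MatrixForms

variable {R : Type*} [CommRing R] {W : Type*} [AddCommGroup W] [Module R W]

theorem isometric_toLinearMap₂'_gram {n : ℕ} (β : LinearMap.BilinForm R W)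
    (b : Module.Basis (Fin n) R W) : Isometric (Matrix.toLinearMap₂' R (gram β b)) β := by
  refine ⟨b.equivFun.symm, fun x y => ?_⟩
  have h : β.compl₁₂ (b.equivFun.symm : (Fin n → R) →ₗ[R] W) (b.equivFun.symm : (Fin n → R) →ₗ[R] W)
      = Matrix.toLinearMap₂' R (gram β b) := by
    ext i j
    simp [gram, Matrix.toLinearMap₂'_apply']
  exact LinearMap.congr_fun (LinearMap.congr_fun h x) y

theorem isometric_perp {m n : ℕ} (M : Matrix (Fin (2 * m)) (Fin (2 * m)) R)
    (N : Matrix (Fin (2 * n)) (Fin (2 * n)) R) :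
    Isometric (Matrix.toLinearMap₂' R (perp M N))
      (formPerp (Matrix.toLinearMap₂' R M) (Matrix.toLinearMap₂' R N)) := by
  let b := ((Pi.basisFun R (Fin (2 * m))).prod (Pi.basisFun R (Fin (2 * n)))).reindex
      (finSumFinEquiv.trans (finCongr (Nat.mul_add 2 m n).symm))
  have h : gram (formPerp (Matrix.toLinearMap₂' R M) (Matrix.toLinearMap₂' R N)) b = perp M N := by
    ext i j
    obtain ⟨i, rfl⟩ := (finSumFinEquiv.trans (finCongr (Nat.mul_add 2 m n).symm)).surjective i
    obtain ⟨j, rfl⟩ := (finSumFinEquiv.trans (finCongr (Nat.mul_add 2 m n).symm)).surjective j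
    rw [perp_apply, gram, Matrix.of_apply, Module.Basis.reindex_apply, Module.Basis.reindex_apply,
      Equiv.symm_apply_apply, Equiv.symm_apply_apply]
    rcases i with i | i <;> rcases j with j | j <;> simp [Matrix.toLinearMap₂'_apply']
  rw [← h]
  exact isometric_toLinearMap₂'_gram _ b

theorem perp_psi (m n : ℕ) : perp (psi R m) (psi R n) = psi R (m + n) := by
  ext i j
  obtain ⟨i, rfl⟩ := (finSumFinEquiv.trans (finCongr (Nat.mul_add 2 m n).symm)).surjective i
  obtain ⟨j, rfl⟩ := (finSumFinEquiv.trans (finCongr (Nat.mul_add 2 m n).symm)).surjective j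
  rw [perp_apply]
  have h : ∀ (p q p' q' : Prop) [Decidable p] [Decidable q] [Decidable p'] [Decidable q'],
      (p ↔ p') → (q ↔ q') → (if p then (1 : R) else if q then -1 else 0) =
        if p' then 1 else if q' then -1 else 0 := by
    intro p q p' q' _ _ _ _ hp hq
    simp only [hp, hq]
  rcases i with i | i <;> rcases j with j | j <;> have hi := i.2 <;> have hj := j.2 <;>
    simp only [Matrix.fromBlocks_apply₁₁, Matrix.fromBlocks_apply₁₂, Matrix.fromBlocks_apply₂₁,
      Matrix.fromBlocks_apply₂₂, psi, Matrix.of_apply, Matrix.zero_apply, Equiv.trans_apply,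
      finSumFinEquiv_apply_left, finSumFinEquiv_apply_right, finCongr_apply, Fin.val_cast,
      Fin.val_castAdd, Fin.val_natAdd]
  · rw [if_neg (by omega), if_neg (by omega)]
  · rw [if_neg (by omega), if_neg (by omega)]
  · exact h _ _ _ _ (by omega) (by omega)

theorem isometric_formPerp_psiForm (m n : ℕ) :
    Isometric (formPerp (psiForm R m) (psiForm R n)) (psiForm R (m + n)) := by
  have h := isometric_perp (psi R m) (psi R n)
  rw [perp_psi] at h
  exact h.symm

theorem isometric_congr {n : ℕ} (M : Matrix (Fin n) (Fin n) R)
    (E : Matrix.SpecialLinearGroup (Fin n) R) :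
    Isometric (Matrix.toLinearMap₂' R (E.1.transpose * M * E.1)) (Matrix.toLinearMap₂' R M) := by
  have h : gram (Matrix.toLinearMap₂' R M)
      ((Pi.basisFun R (Fin n)).map (Matrix.SpecialLinearGroup.toLin' E)) =
        E.1.transpose * M * E.1 := by
    ext i j
    simp only [gram, Matrix.of_apply, Module.Basis.map_apply, Pi.basisFun_apply,
      Matrix.SpecialLinearGroup.toLin'_apply, Matrix.toLinearMap₂'_apply']
    simp only [Matrix.toLin'_apply, Matrix.mulVec_single_one]
    rw [Matrix.mul_assoc, Matrix.mul_apply]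
    rfl
  rw [← h]
  exact isometric_toLinearMap₂'_gram _ _

theorem isometric_reindex {m n : ℕ} (e : Fin m ≃ Fin n) (M : Matrix (Fin m) (Fin m) R) :
    Isometric (Matrix.toLinearMap₂' R (Matrix.reindex e e M)) (Matrix.toLinearMap₂' R M) := by
  have h : gram (Matrix.toLinearMap₂' R M) ((Pi.basisFun R (Fin m)).reindex e) =
      Matrix.reindex e e M := by
    ext i j
    simp [gram, Matrix.toLinearMap₂'_apply']
  rw [← h]
  exact isometric_toLinearMap₂'_gram _ _

/-- Isometric alternating matrices of Pfaffian `1` are congruent under `SL`. -/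
theorem exists_congr_of_isometric {n : ℕ} {M N : Matrix (Fin (2 * n)) (Fin (2 * n)) R}
    (hN : N.transpose = -N) (hd : ∀ i, N i i = 0) (hM1 : pf n M = 1) (hN1 : pf n N = 1)
    (h : Isometric (Matrix.toLinearMap₂' R M) (Matrix.toLinearMap₂' R N)) :
    ∃ E : Matrix.SpecialLinearGroup (Fin (2 * n)) R, M = E.1.transpose * N * E.1 := by
  obtain ⟨e, he⟩ := h
  let E := LinearMap.toMatrix' (e : (Fin (2 * n) → R) →ₗ[R] (Fin (2 * n) → R))
  have hE : M = E.transpose * N * E := by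
    ext i j
    have h := he (Pi.single i 1) (Pi.single j 1)
    simp only [Matrix.toLinearMap₂'_apply', Matrix.mulVec_single_one, single_one_dotProduct] at h
    rw [Matrix.mul_assoc, Matrix.mul_apply]
    change _ = M i j at h
    rw [← h]
    simp only [E, LinearMap.toMatrix'_apply, Matrix.transpose_apply, dotProduct, Matrix.mul_apply,
      Matrix.mulVec, LinearEquiv.coe_coe]
  refine ⟨⟨E, ?_⟩, hE⟩
  have h1 := pf_congr N E hN hd
  rw [← hE, hM1, hN1, mul_one] at h1
  exact h1.symm

/-- The matrix becomes isometric to a standard one after adding a standard one. -/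
def StablyTrivial (x : Σ n, A R n) : Prop :=
  ∃ k, Isometric (formPerp (Matrix.toLinearMap₂' R x.2.1) (psiForm R k)) (psiForm R (x.1 + k))

theorem StablyTrivial.of_isometric {x y : Σ n, A R n} {a b : ℕ} (hab : x.1 + a = y.1 + b)
    (h : Isometric (formPerp (Matrix.toLinearMap₂' R x.2.1) (psiForm R a))
      (formPerp (Matrix.toLinearMap₂' R y.2.1) (psiForm R b))) (hx : StablyTrivial x) :
    StablyTrivial y := by
  obtain ⟨k, hk⟩ := hx
  refine ⟨b + k, ?_⟩
  have e : y.1 + (b + k) = x.1 + k + a := by omega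
  rw [e]
  have h1 := (isometric_formPerp_psiForm (R := R) b k).symm
  have h2 := isometric_formPerp_comm (psiForm R a) (psiForm R k)
  refine ((Isometric.refl _).formPerp h1).trans ?_
  refine (isometric_formPerp_assoc _ _ _).symm.trans ?_
  refine (h.symm.formPerp (Isometric.refl _)).trans ?_
  refine (isometric_formPerp_assoc _ _ _).trans ?_
  refine ((Isometric.refl _).formPerp h2).trans ?_
  refine (isometric_formPerp_assoc _ _ _).symm.trans ?_
  exact (hk.formPerp (Isometric.refl _)).trans (isometric_formPerp_psiForm _ _)

/-- `WSL'` is a bare quotient by a relation, so equality of classes is exploited through a predicate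
invariant under the relation. -/
theorem SLEquiv.stablyTrivial_iff {x y : Σ n, A R n} (h : SLEquiv x y) :
    StablyTrivial x ↔ StablyTrivial y := by
  obtain ⟨s, E, h⟩ := h
  have h1 := isometric_perp x.2.1 (psi R (y.1 + s))
  rw [h] at h1
  have h2 := (h1.symm.trans (isometric_congr _ E)).trans
    ((isometric_reindex _ _).trans (isometric_perp y.2.1 (psi R (x.1 + s))))
  have hab : x.1 + (y.1 + s) = y.1 + (x.1 + s) := by omega
  exact ⟨StablyTrivial.of_isometric hab h2, StablyTrivial.of_isometric hab.symm h2.symm⟩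

theorem stablyTrivial_of_mk_eq_zero {n : ℕ} (M : A R n) (h : WSL'.mk M = WSL'.zero R) :
    StablyTrivial ⟨n, M⟩ := by
  let T : WSL' R → Prop := Quot.lift StablyTrivial fun _ _ h => propext h.stablyTrivial_iff
  have h1 : T (WSL'.mk M) := by
    rw [h]
    exact ⟨0, isometric_formPerp_psiForm 0 0⟩
  exact h1

/-- Both stabilized matrices have Pfaffian `1`, so an isometry between them automatically has
determinant `1`. -/
theorem mk_eq_zero_of_isometric {n k : ℕ} (M : A R n) (h1 : pf n M.1 = 1)
    (h : Isometric (formPerp (Matrix.toLinearMap₂' R M.1) (psiForm R k)) (psiForm R (n + k))) :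
    WSL'.mk M = WSL'.zero R := by
  refine Quot.sound ⟨k, ?_⟩
  have e : ∀ (l l' : ℕ) (hl : 2 * l = 2 * l'),
      Matrix.reindex (finCongr hl) (finCongr hl) (psi R l) = psi R l' := by
    intro l l' hl
    ext i j
    rfl
  change ∃ E : Matrix.SpecialLinearGroup (Fin (2 * (n + (0 + k)))) R,
    perp M.1 (psi R (0 + k)) = E.1.transpose * Matrix.reindex (finCongr _) (finCongr _)
      (perp (psi R 0) (psi R (n + k))) * E.1
  rw [perp_psi, e]
  refine exists_congr_of_isometric (psi_transpose _) (psi_diag _) ?_ (pf_psi _) ?_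
  · rw [pf_perp, h1, pf_psi, mul_one]
  · refine (isometric_perp _ _).trans ?_
    have := h
    rw [← Nat.zero_add k] at this
    exact this

end MatrixForms

/-! ### Reduction of forms to a multiple of χ₀ plus a standard form -/

section Reduction

variable {R : Type*} [CommRing R] {P : Type*} [AddCommGroup P] [Module R P]

/-- The automorphism induced modulo the fixed vector; its inverse is induced by `Ψ⁻¹`. -/
theorem exists_linearEquiv_fst {V : Type*} [AddCommGroup V] [Module R V] (Ψ : (V × R) ≃ₗ[R] V × R)
    (h : Ψ (0, 1) = (0, 1)) : ∃ φ : V ≃ₗ[R] V, ∀ v, (Ψ (v, 0)).1 = φ v := by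
  have h' : Ψ.symm (0, 1) = (0, 1) := by rw [LinearEquiv.symm_apply_eq, h]
  have key : ∀ Θ : (V × R) ≃ₗ[R] V × R, Θ (0, 1) = (0, 1) → ∀ v r,
      (Θ (v, r)).1 = (Θ (v, 0)).1 := by
    intro Θ hΘ v r
    have e : (v, r) = (v, 0) + r • ((0 : V), (1 : R)) := by simp
    rw [e, map_add, map_smul, hΘ]
    simp
  let f : V →ₗ[R] V := LinearMap.fst R V R ∘ₗ (Ψ : (V × R) →ₗ[R] V × R) ∘ₗ LinearMap.inl R V R
  let g : V →ₗ[R] V := LinearMap.fst R V R ∘ₗ (Ψ.symm : (V × R) →ₗ[R] V × R) ∘ₗ LinearMap.inl R V R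
  have hf : ∀ v, f v = (Ψ (v, 0)).1 := fun _ => rfl
  have hg : ∀ v, g v = (Ψ.symm (v, 0)).1 := fun _ => rfl
  refine ⟨LinearEquiv.ofLinearMap f g ?_ ?_, fun v => rfl⟩
  · refine LinearMap.ext fun v => ?_
    rw [LinearMap.comp_apply, hf, hg, ← key Ψ h _ (Ψ.symm (v, 0)).2, Prod.mk.eta,
      Ψ.apply_symm_apply]
    rfl
  · refine LinearMap.ext fun v => ?_
    rw [LinearMap.comp_apply, hg, hf, ← key Ψ.symm h' _ (Ψ (v, 0)).2, Prod.mk.eta,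
      Ψ.symm_apply_apply]
    rfl

/-- An alternating form on `P ⊕ R⁰` is a multiple of `χ₀`. -/
theorem exists_eq_formPerp_zero (θ₀ : R ≃ₗ[R] ⋀[R]^2 P)
    (α : LinearMap.BilinForm R (P × (Fin (2 * 0) → R))) (hα : ∀ x, α x x = 0) :
    ∃ u : R, ∀ x y, α x y = formPerp (u • chi₀ θ₀) (psiForm R 0) x y := by
  obtain ⟨u, hu⟩ := exists_eq_mul_chi₀ θ₀
    (α.compl₁₂ (LinearMap.inl R P _) (LinearMap.inl R P _)) fun x => hα _
  refine ⟨u, fun x y => ?_⟩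
  have e : ∀ x : P × (Fin (2 * 0) → R), x = (x.1, 0) := fun x => Prod.ext rfl (by
    ext i
    exact i.elim0)
  rw [e x, e y, formPerp_apply, map_zero, add_zero]
  exact hu x.1 y.1

variable [Module.Finite R P] [Module.Projective R P]

theorem UmTransitive.exists_snocEquiv₂ {n : ℕ}
    (h : UmTransitive R ((P × (Fin (2 * n) → R)) × R))
    (ω : LinearMap.BilinForm R (P × (Fin (2 * (n + 1)) → R))) (hω : ∀ x, ω x x = 0)
    (hp : IsPerfect ω) :
    ∃ φ ∈ SL R (P × (Fin (2 * (n + 1)) → R)),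
      φ (snocEquiv₂ R P n ((0, 0), 1)) = snocEquiv₂ R P n ((0, 0), 1) ∧
      ∃ α : LinearMap.BilinForm R (P × (Fin (2 * n) → R)), (∀ x, α x x = 0) ∧ IsPerfect α ∧
        ∀ x y, ω (φ (snocEquiv₂ R P n x)) (φ (snocEquiv₂ R P n y)) = hyp α x y := by
  let e := snocEquiv₂ R P n
  let ω' := ω.compl₁₂
    (e : (((P × (Fin (2 * n) → R)) × R) × R) →ₗ[R] P × (Fin (2 * (n + 1)) → R))
    (e : (((P × (Fin (2 * n) → R)) × R) × R) →ₗ[R] P × (Fin (2 * (n + 1)) → R))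
  have hω' : Isometric ω ω' := Isometric.symm ⟨e, fun x y => rfl⟩
  obtain ⟨φ, hφ, hφe, α, hα, h⟩ := h.exists_hyp ω' (fun x => hω _) (hp.of_isometric hω')
  have hh : Isometric ω' (hyp α) := Isometric.symm ⟨φ, h⟩
  refine ⟨_, conj_mem_SL e hφ, ?_, α, hα, ((hp.of_isometric hω').of_isometric hh).of_hyp, ?_⟩
  · change e (φ (e.symm (e _))) = _
    rw [e.symm_apply_apply, hφe]
  · intro x y
    change ω (e (φ (e.symm (e x)))) (e (φ (e.symm (e y)))) = _
    rw [e.symm_apply_apply, e.symm_apply_apply]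
    exact h x y

/-- Hyperbolic planes are split off one at a time down to `P ⊕ R⁰`, where an alternating form is a
multiple of `χ₀`. -/
theorem exists_mem_SL_formPerp (θ₀ : R ≃ₗ[R] ⋀[R]^2 P)
    (h : ∀ n : ℕ, UmTransitive R ((P × (Fin (2 * n) → R)) × R)) (n : ℕ)
    (ω : LinearMap.BilinForm R (P × (Fin (2 * n) → R))) (hω : ∀ x, ω x x = 0)
    (hp : IsPerfect ω) : ∃ φ ∈ SL R (P × (Fin (2 * n) → R)), ∃ u : R,
      ∀ x y, ω (φ x) (φ y) = formPerp (u • chi₀ θ₀) (psiForm R n) x y := by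
  induction n with
  | zero =>
    obtain ⟨u, hu⟩ := exists_eq_formPerp_zero θ₀ ω hω
    exact ⟨1, one_mem _, u, hu⟩
  | succ n ih =>
    let e := snocEquiv₂ R P n
    obtain ⟨φ, hφ, -, α, hα, hαp, h1⟩ := (h n).exists_snocEquiv₂ ω hω hp
    obtain ⟨ψ, hψ, u, h2⟩ := ih α hα hαp
    let Ψ := (ψ.prodCongr (LinearEquiv.refl R R)).prodCongr (LinearEquiv.refl R R)
    have hΨ : Ψ ∈ SL R (((P × (Fin (2 * n) → R)) × R) × R) :=
      prodCongr_mem_SL (prodCongr_mem_SL hψ)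
    refine ⟨φ * (e.symm.trans Ψ).trans e, mul_mem hφ (conj_mem_SL e hΨ), u, fun x y => ?_⟩
    obtain ⟨x, rfl⟩ := e.surjective x
    obtain ⟨y, rfl⟩ := e.surjective y
    change ω (φ (e (Ψ (e.symm (e x))))) (φ (e (Ψ (e.symm (e y))))) = _
    rw [e.symm_apply_apply, e.symm_apply_apply, h1, hyp_apply]
    simp only [Ψ, LinearEquiv.prodCongr_apply, LinearEquiv.refl_apply, h2]
    rw [formPerp_apply, formPerp_apply, snocEquiv₂_apply, snocEquiv₂_apply, psiForm_succ, add_assoc]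

end Reduction

/-! ### Stable cancellation of χ, and determinants of isometries -/

namespace PlaneFrame

variable {R : Type*} [CommRing R] {P : Type*} [AddCommGroup P] [Module R P]
  {χ : LinearMap.BilinForm R P} {m : ℕ}

theorem isPerfect_formPerp_psiForm (D : PlaneFrame χ m) (n : ℕ) :
    IsPerfect (formPerp χ (psiForm R n)) :=
  IsPerfect.formPerp D.perfect (isPerfect_psiForm n)

/-- `ψ_{2m}` is isometric to the orthogonal sum of `χ` and a form on the kernel of `ret`. -/
theorem exists_isometric_psiForm (D : PlaneFrame χ m) :
    ∃ κ : LinearMap.BilinForm R (LinearMap.ker D.ret),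
      Isometric (psiForm R m) (formPerp χ κ) := by
  let K := LinearMap.ker D.ret
  let κ : LinearMap.BilinForm R K := (psiForm R m).compl₁₂ K.subtype K.subtype
  let e : (P × K) ≃ₗ[R] (Fin (2 * m) → R) :=
    { D.emb.coprod K.subtype with
      invFun := fun v => (D.ret v, ⟨v - D.emb (D.ret v), by simp [K]⟩)
      left_inv := by
        rintro ⟨p, k, hk⟩
        have hk' : D.ret k = 0 := hk
        refine Prod.ext ?_ (Subtype.ext ?_)
        · simp [hk']
        · simp [hk']
      right_inv := fun v => by simp }
  refine ⟨κ, Isometric.symm ⟨e, ?_⟩⟩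
  rintro ⟨p, k, hk⟩ ⟨q, l, hl⟩
  have hk' : D.ret k = 0 := hk
  have hl' : D.ret l = 0 := hl
  change psiForm R m (D.emb p + k) (D.emb q + l) = χ p q + psiForm R m k l
  simp [psiForm_emb, psiForm_emb_right, hk', hl']

/-- Add the complement `κ` of `χ` in `ψ_{2m}` to both sides, so that `χ` is absorbed into a standard
form. -/
theorem isometric_formPerp_psiForm_of (D : PlaneFrame χ m) {n k : ℕ}
    (β : LinearMap.BilinForm R (Fin k → R))
    (h : Isometric (formPerp χ β) (formPerp χ (psiForm R n))) :
    Isometric (formPerp β (psiForm R m)) (psiForm R (n + m)) := by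
  obtain ⟨κ, hκ⟩ := D.exists_isometric_psiForm
  have swap : ∀ (l : ℕ) (γ : LinearMap.BilinForm R (Fin l → R)),
      Isometric (RankTwo.formPerp γ (psiForm R m)) (RankTwo.formPerp (RankTwo.formPerp χ γ) κ) :=
    fun l γ => ((Isometric.refl γ).formPerp hκ).trans
      ((isometric_formPerp_assoc γ χ κ).symm.trans
        ((isometric_formPerp_comm γ χ).formPerp (Isometric.refl κ)))
  exact (swap k β).trans ((h.formPerp (Isometric.refl κ)).trans
    ((swap _ _).symm.trans (isometric_formPerp_psiForm n m)))

theorem relPf_chi (D : PlaneFrame χ m) (n : ℕ) :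
    D.relPf n (formPerp χ (psiForm R n)) = 1 := by
  have h := D.relPf_formPerp_psiForm n 1
  rwa [one_smul] at h

variable [Module.Finite R P] [Module.Projective R P]

/-- Comparing relative Pfaffians on the two sides of the isometry reads off its determinant. -/
theorem mem_SL_of_isometry (D : PlaneFrame χ m) {n : ℕ}
    {ω : LinearMap.BilinForm R (P × (Fin (2 * n) → R))} (h1 : D.relPf n ω = 1)
    (φ : (P × (Fin (2 * n) → R)) ≃ₗ[R] P × (Fin (2 * n) → R))
    (h : ∀ x y, formPerp χ (psiForm R n) (φ x) (φ y) = ω x y) :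
    φ ∈ SL R (P × (Fin (2 * n) → R)) := by
  have h2 := D.relPf_comp n (formPerp χ (psiForm R n)) (D.formPerp_psiForm_self n)
    (φ : (P × (Fin (2 * n) → R)) →ₗ[R] _)
  have e : (formPerp χ (psiForm R n)).compl₁₂ (φ : (P × (Fin (2 * n) → R)) →ₗ[R] _)
      (φ : (P × (Fin (2 * n) → R)) →ₗ[R] _) = ω := LinearMap.ext₂ h
  rw [e, h1, relPf_chi, mul_one] at h2
  exact h2.symm

theorem Sp_le_SL (D : PlaneFrame χ m) (n : ℕ) :
    Sp (formPerp χ (psiForm R n)) ≤ SL R (P × (Fin (2 * n) → R)) := fun φ hφ =>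
  D.mem_SL_of_isometry (D.relPf_chi n) φ hφ

theorem eq_relPf_of_isometry (D : PlaneFrame χ m) {n : ℕ}
    {ω : LinearMap.BilinForm R (P × (Fin (2 * n) → R))} (hω : ∀ x, ω x x = 0)
    {φ : (P × (Fin (2 * n) → R)) ≃ₗ[R] P × (Fin (2 * n) → R)}
    (hφ : φ ∈ SL R (P × (Fin (2 * n) → R))) {u : R}
    (h : ∀ x y, ω (φ x) (φ y) = formPerp (u • χ) (psiForm R n) x y) : u = D.relPf n ω := by
  have h2 := D.relPf_comp n ω hω (φ : (P × (Fin (2 * n) → R)) →ₗ[R] _)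
  have e : ω.compl₁₂ (φ : (P × (Fin (2 * n) → R)) →ₗ[R] _)
      (φ : (P × (Fin (2 * n) → R)) →ₗ[R] _) = formPerp (u • χ) (psiForm R n) := LinearMap.ext₂ h
  rwa [e, relPf_formPerp_psiForm, mem_SL.1 hφ, one_mul] at h2

end PlaneFrame

/-! ### The two implications -/

section Main

variable {R : Type*} [CommRing R] {P : Type*} [AddCommGroup P] [Module R P]

theorem e₄_eq : e₄ R P = snocEquiv₂ R P 0 ((0, 0), 1) := by
  rw [snocEquiv₂_apply]
  refine Prod.ext rfl ?_
  ext i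
  fin_cases i <;> rfl

/-- `ω̂` is a matrix of Pfaffian `1`, hence stably trivial. Therefore `ω ⊥ ψ_{2m+2k} ≅ χ ⊥ ω̂ ⊥
ψ_{2k} ≅ χ ⊥ ψ_{2+2m+2k}`, and the standard summand cancels by the dimension bound. -/
theorem PlaneFrame.isometric_vasersteinForm [IsNoetherianRing R] (hdim : ringKrullDim R ≤ 4)
    {χ : LinearMap.BilinForm R P} {m : ℕ} (D : PlaneFrame χ m) (hW : WSL R = {WSL'.zero R})
    (ω : LinearMap.BilinForm R (P × (Fin (2 * 1) → R))) (hω : ∀ x, ω x x = 0)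
    (h1 : D.relPf 1 ω = 1) : Isometric ω (formPerp χ (psiForm R 1)) := by
  let b := ((Pi.basisFun R (Fin (2 * 1))).prod (Pi.basisFun R (Fin (2 * m)))).reindex
    (finSumFinEquiv.trans (finCongr (Nat.mul_add 2 1 m).symm))
  have hd : ∀ i, gram (D.hat ω) b i i = 0 := fun i => D.hat_self ω hω _
  have ht : (gram (D.hat ω) b).transpose = - gram (D.hat ω) b := by
    ext i j
    exact neg_of_self_eq_zero (D.hat_self ω hω) _ _
  let M : A R (1 + m) := ⟨gram (D.hat ω) b, ht, hd, isUnit_of_pf_eq_one _ ht hd h1⟩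
  have hM : WSL'.mk M = WSL'.zero R := by
    have : WSL'.mk M ∈ WSL R := ⟨1 + m, M, rfl, h1⟩
    rwa [hW] at this
  obtain ⟨k, hk⟩ := stablyTrivial_of_mk_eq_zero M hM
  refine D.isometric_of_formPerp_psiForm hdim ω (m + k) ?_
  rw [← Nat.add_assoc]
  have hh : Isometric (D.hat ω) (Matrix.toLinearMap₂' R M.1) :=
    (isometric_toLinearMap₂'_gram (D.hat ω) b).symm
  refine ((Isometric.refl ω).formPerp (RankTwo.isometric_formPerp_psiForm m k).symm).trans ?_
  refine (isometric_formPerp_assoc _ _ _).symm.trans ?_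
  refine ((D.isometric_formPerp_hat ω).formPerp (Isometric.refl _)).trans ?_
  refine (isometric_formPerp_assoc _ _ _).trans ?_
  exact (Isometric.refl χ).formPerp ((hh.formPerp (Isometric.refl _)).trans hk)

variable [Module.Finite R P] [Module.Projective R P]

theorem umTransitive_iff : UmTransitive R P ↔ ∀ x y : UmModSL R P, x = y := by
  constructor
  · intro h x y
    induction x using Quotient.inductionOn with | _ a
    induction y using Quotient.inductionOn with | _ b
    exact Quotient.sound (h a.1 a.2 b.1 b.2)
  · intro h a ha b hb
    exact Quotient.exact (s := umSetoid R P) (h (Quotient.mk (umSetoid R P) ⟨a, ha⟩)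
      (Quotient.mk (umSetoid R P) ⟨b, hb⟩))

theorem WSL_eq_zero_of_umTransitive (θ₀ : R ≃ₗ[R] ⋀[R]^2 P)
    (h : ∀ n : ℕ, UmTransitive R ((P × (Fin (2 * n) → R)) × R)) : WSL R = {WSL'.zero R} := by
  obtain ⟨m, ⟨D⟩⟩ := exists_planeFrame θ₀
  refine Set.eq_singleton_iff_unique_mem.2 ⟨⟨0, _, rfl, rfl⟩, ?_⟩
  rintro _ ⟨n, M, rfl, hM⟩
  let β : LinearMap.BilinForm R (Fin (2 * n) → R) := Matrix.toLinearMap₂' R M.1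
  let ω := formPerp (chi₀ θ₀) β
  have hβ : ∀ x, β x x = 0 := toLinearMap₂'_self_eq_zero M.1 M.2.1 M.2.2.1
  have hω : ∀ x, ω x x = 0 := fun x => by
    rw [formPerp_apply, D.alt, hβ, add_zero]
  have hp : IsPerfect ω := IsPerfect.formPerp D.perfect (isPerfect_toLinearMap₂' M.2.2.2)
  obtain ⟨φ, hφ, u, h1⟩ := exists_mem_SL_formPerp θ₀ h n ω hω hp
  have hu := D.eq_relPf_of_isometry hω hφ h1
  have h2 := D.relPf_formPerp n 1 β
  rw [gram_toLinearMap₂', hM, one_smul, mul_one] at h2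
  rw [h2] at hu
  rw [hu, one_smul] at h1
  exact mk_eq_zero_of_isometric M hM
    (D.isometric_formPerp_psiForm_of β (Isometric.symm ⟨φ, h1⟩))

/-- Pull the form back by `φ` and normalize it by some `ρ` fixing the last basis vector. The
relative Pfaffian forces the scalar `u` to be `1`, so `φρ` is symplectic and agrees with `φ` on that
vector. -/
theorem exists_mem_Sp_eq (θ₀ : R ≃ₗ[R] ⋀[R]^2 P) {m : ℕ} (D : PlaneFrame (chi₀ θ₀) m)
    (h : UmTransitive R ((P × (Fin (2 * 0) → R)) × R))
    {φ : (P × (Fin (2 * (0 + 1)) → R)) ≃ₗ[R] P × (Fin (2 * (0 + 1)) → R)}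
    (hφ : φ ∈ SL R (P × (Fin (2 * (0 + 1)) → R))) :
    ∃ τ ∈ Sp (formPerp (chi₀ θ₀) (psiForm R (0 + 1))),
      τ (snocEquiv₂ R P 0 ((0, 0), 1)) = φ (snocEquiv₂ R P 0 ((0, 0), 1)) := by
  have hω₀ := D.formPerp_psiForm_self (0 + 1)
  have hp := D.isPerfect_formPerp_psiForm (0 + 1)
  generalize hωe : formPerp (chi₀ θ₀) (psiForm R (0 + 1)) = ω₀ at hω₀ hp ⊢
  let ω := ω₀.compl₁₂ (φ : (P × (Fin (2 * (0 + 1)) → R)) →ₗ[R] P × (Fin (2 * (0 + 1)) → R))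
    (φ : (P × (Fin (2 * (0 + 1)) → R)) →ₗ[R] P × (Fin (2 * (0 + 1)) → R))
  have hω : Isometric ω₀ ω := Isometric.symm ⟨φ, fun _ _ => rfl⟩
  obtain ⟨ρ, hρ, hρe, α, hα, -, h1⟩ := h.exists_snocEquiv₂ ω (fun x => hω₀ _)
    (hp.of_isometric hω)
  obtain ⟨u, hu⟩ := exists_eq_formPerp_zero θ₀ α hα
  have h2 : ∀ x y, ω₀ ((φ * ρ) x) ((φ * ρ) y) =
      formPerp (u • chi₀ θ₀) (psiForm R (0 + 1)) x y := by
    intro x y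
    obtain ⟨x, rfl⟩ := (snocEquiv₂ R P 0).surjective x
    obtain ⟨y, rfl⟩ := (snocEquiv₂ R P 0).surjective y
    refine (h1 x y).trans ?_
    rw [hyp_apply, hu, formPerp_apply, formPerp_apply, snocEquiv₂_apply, snocEquiv₂_apply,
      psiForm_succ, add_assoc]
  have hu1 := D.eq_relPf_of_isometry hω₀ (mul_mem hφ hρ) h2
  rw [← hωe, D.relPf_chi] at hu1
  rw [hu1, one_smul, hωe] at h2
  exact ⟨φ * ρ, h2, congrArg φ hρe⟩

theorem image_e₄_eq_of_umTransitive (θ₀ : R ≃ₗ[R] ⋀[R]^2 P)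
    (h : UmTransitive R ((P × (Fin (2 * 0) → R)) × R)) :
    (fun φ : Pn R P 4 ≃ₗ[R] Pn R P 4 => φ (e₄ R P)) '' (SL R (Pn R P 4)) =
      (fun φ : Pn R P 4 ≃ₗ[R] Pn R P 4 => φ (e₄ R P)) ''
        (Sp (formPerp (chi₀ θ₀) (psiForm R 1))) := by
  obtain ⟨m, ⟨D⟩⟩ := exists_planeFrame θ₀
  rw [e₄_eq]
  refine Set.Subset.antisymm ?_ ?_
  · rintro _ ⟨φ, hφ, rfl⟩
    obtain ⟨τ, hτ, h'⟩ := exists_mem_Sp_eq θ₀ D h hφ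
    exact ⟨τ, hτ, h'⟩
  · rintro _ ⟨φ, hφ, rfl⟩
    exact ⟨φ, D.Sp_le_SL 1 hφ, rfl⟩

/-- `(P ⊕ R) ⊕ R ≅ P ⊕ R²`. -/
def pairEquiv (R P : Type*) [CommRing R] [AddCommGroup P] [Module R P] :
    ((P × R) × R) ≃ₗ[R] P × (Fin (2 * 1) → R) where
  toFun z := (z.1.1, ![z.1.2, z.2])
  invFun z := ((z.1, z.2 0), z.2 1)
  left_inv z := rfl
  right_inv z := Prod.ext rfl (by
    ext i
    fin_cases i <;> rfl)
  map_add' z w := Prod.ext rfl (by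
    ext i
    fin_cases i <;> rfl)
  map_smul' c z := Prod.ext rfl (by
    ext i
    fin_cases i <;> rfl)

/-- Take `(σ, s)` with `a(σ, s) = 1` and let `α` represent `-a` on `P`. The relative Pfaffian `s
a(0,1) + χ(σ, α)` is then exactly `a(σ, s)`. -/
theorem PlaneFrame.exists_vasersteinForm {χ : LinearMap.BilinForm R P} {m : ℕ}
    (D : PlaneFrame χ m) {a : (P × R) →ₗ[R] R} (ha : a ∈ Um R (P × R)) :
    ∃ (u b : R) (σ α : P), D.relPf 1 (PlaneFrame.vasersteinForm χ u b σ α) = 1 ∧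
      ∀ x : P × (Fin (2 * 1) → R), PlaneFrame.vasersteinForm χ u b σ α x (0, ![0, 1]) =
        a (x.1, x.2 0) := by
  obtain ⟨⟨σ, s⟩, hs⟩ := ha 1
  obtain ⟨α, hα⟩ := D.perfect (-(a ∘ₗ LinearMap.inl R P R))
  have h1 : ∀ p r, a (p, r) = - χ α p + r * a (0, 1) := fun p r => by
    rw [hα, ← smul_eq_mul, ← map_smul, LinearMap.neg_apply, neg_neg, LinearMap.comp_apply, ← map_add]
    simp
  refine ⟨s, a (0, 1), σ, α, ?_, fun x => ?_⟩
  · have h2 := h1 σ s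
    rw [hs, D.neg σ α] at h2
    rw [D.relPf_vasersteinForm]
    linear_combination -h2
  · have h2 := h1 x.1 (x.2 0)
    rw [PlaneFrame.vasersteinForm_apply, h2]
    simp only [map_zero, Matrix.cons_val_zero, Matrix.cons_val_one]
    ring

theorem umTransitive_of_WSL_eq_zero [IsNoetherianRing R] (hdim : ringKrullDim R ≤ 4)
    (θ₀ : R ≃ₗ[R] ⋀[R]^2 P) (hW : WSL R = {WSL'.zero R})
    (hS : (fun φ : Pn R P 4 ≃ₗ[R] Pn R P 4 => φ (e₄ R P)) '' (SL R (Pn R P 4)) =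
      (fun φ : Pn R P 4 ≃ₗ[R] Pn R P 4 => φ (e₄ R P)) ''
        (Sp (formPerp (chi₀ θ₀) (psiForm R 1)))) :
    UmTransitive R (P × R) := by
  obtain ⟨m, ⟨D⟩⟩ := exists_planeFrame θ₀
  refine umTransitive_of_forall (LinearMap.snd R P R) fun a ha => ?_
  obtain ⟨u, b, σ, α, h1, ha'⟩ := D.exists_vasersteinForm ha
  set ω := PlaneFrame.vasersteinForm (chi₀ θ₀) u b σ α
  have hω : ∀ x, ω x x = 0 := D.vasersteinForm_self u b σ α
  obtain ⟨φ, hφ⟩ := D.isometric_vasersteinForm hdim hW ω hω h1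
  have hφSL : φ ∈ SL R (Pn R P 4) := D.mem_SL_of_isometry h1 φ hφ
  obtain ⟨τ, hτ, hτe⟩ : φ (e₄ R P) ∈ (fun φ : Pn R P 4 ≃ₗ[R] Pn R P 4 => φ (e₄ R P)) ''
      (Sp (formPerp (chi₀ θ₀) (psiForm R 1))) := hS ▸ ⟨φ, hφSL, rfl⟩
  -- `φ` corrected to fix `e₄`, while still carrying `ω` to the standard form.
  let ε : Pn R P 4 ≃ₗ[R] Pn R P 4 := τ⁻¹ * φ
  have hε : ε ∈ SL R (Pn R P 4) := mul_mem (inv_mem (D.Sp_le_SL 1 hτ)) hφSL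
  have hεe : ε (e₄ R P) = e₄ R P := by
    change τ.symm (φ (e₄ R P)) = _
    rw [LinearEquiv.symm_apply_eq]
    exact hτe.symm
  have hεω : ∀ x y, formPerp (chi₀ θ₀) (psiForm R 1) (ε x) (ε y) = ω x y := fun x y =>
    ((inv_mem hτ : τ⁻¹ ∈ Sp (formPerp (chi₀ θ₀) (psiForm R 1))) _ _).trans (hφ x y)
  -- Pairing with `e₄` in the standard form extracts the `e₃`-coordinate, and `ε` fixes `e₄`; so
  -- this coordinate of `ε x` is `ω(x, e₄)`.
  have hε0 : ∀ x, (ε x).2 0 = a (x.1, x.2 0) := fun x => by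
    rw [← ha']
    change _ = ω x (e₄ R P)
    rw [← hεω, hεe, formPerp_apply, psiForm_one]
    simp [e₄]
  let e := pairEquiv R P
  let Ψ : ((P × R) × R) ≃ₗ[R] (P × R) × R := (e.trans ε).trans e.symm
  have hΨ : Ψ ∈ SL R ((P × R) × R) := conj_mem_SL e.symm hε
  have hΨe : Ψ (0, 1) = (0, 1) := by
    change e.symm (ε (e₄ R P)) = _
    rw [hεe]
    rfl
  obtain ⟨ψ, hψ⟩ := exists_linearEquiv_fst Ψ hΨe
  have hψSL : ψ ∈ SL R (P × R) := mem_SL_of_fst hΨ hΨe ψ hψ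
  have hψa : ∀ v, (ψ v).2 = a v := fun v => by
    rw [← hψ]
    exact hε0 (e (v, 0))
  refine ⟨ψ⁻¹, inv_mem hψSL, LinearMap.ext fun v => ?_⟩
  change a (ψ.symm v) = v.2
  rw [← hψa, ψ.apply_symm_apply]

end Main

end RankTwo

theorem corollary3p7 {R : Type*} [CommRing R] [IsNoetherianRing R] (hdim : ringKrullDim R ≤ 4)
    {P₀ : Type*} [AddCommGroup P₀] [Module R P₀] [Module.Finite R P₀] [Module.Projective R P₀]
    (hrank : ∀ p : PrimeSpectrum R, Module.rankAtStalk P₀ p = 2)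
    (θ₀ : R ≃ₗ[R] ⋀[R]^2 P₀)
    (hP₅ : ∀ a ∈ RankTwo.Um R (RankTwo.Pn R P₀ 5), ∀ b ∈ RankTwo.Um R (RankTwo.Pn R P₀ 5),
      ∃ φ ∈ RankTwo.SL R (RankTwo.Pn R P₀ 5),
        a ∘ₗ (φ : RankTwo.Pn R P₀ 5 →ₗ[R] RankTwo.Pn R P₀ 5) = b) :
    (∀ x y : RankTwo.UmModSL R (P₀ × R), x = y) ↔
      RankTwo.WSL R = {RankTwo.WSL'.zero R} ∧
      (fun φ : RankTwo.Pn R P₀ 4 ≃ₗ[R] RankTwo.Pn R P₀ 4 => φ (RankTwo.e₄ R P₀)) ''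
          (RankTwo.SL R (RankTwo.Pn R P₀ 4)) =
        (fun φ : RankTwo.Pn R P₀ 4 ≃ₗ[R] RankTwo.Pn R P₀ 4 => φ (RankTwo.e₄ R P₀)) ''
          (RankTwo.Sp (RankTwo.formPerp (RankTwo.chi₀ θ₀) (RankTwo.psiForm R 1))) := by
  rw [← RankTwo.umTransitive_iff]
  constructor
  · intro h3
    obtain ⟨m, ⟨D⟩⟩ := RankTwo.exists_planeFrame θ₀
    have h : ∀ n : ℕ, RankTwo.UmTransitive R ((P₀ × (Fin (2 * n) → R)) × R) := by
      intro n
      -- The case `n = 0` is the assumption on `P₀ ⊕ R`, `n = 1` is the hypothesis on `P₅`, and from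
      -- `n = 2` on there are at least `4` free coordinates, so the stable range theorem applies.
      rcases n with _ | _ | n
      · refine h3.of_equiv ?_
        exact (LinearEquiv.ofLinearMap (LinearMap.inl R P₀ (Fin (2 * 0) → R)) (LinearMap.fst R P₀ _)
          (LinearMap.ext fun x => Prod.ext rfl (by ext i; exact i.elim0)) rfl).prodCongr
            (LinearEquiv.refl R R)
      · exact RankTwo.UmTransitive.of_equiv (RankTwo.snocEquiv R P₀ 2).symm hP₅
      · exact D.umTransitive hdim (by omega)
    exact ⟨RankTwo.WSL_eq_zero_of_umTransitive θ₀ h,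
      RankTwo.image_e₄_eq_of_umTransitive θ₀ (h 0)⟩
  · rintro ⟨hW, hS⟩
    exact RankTwo.umTransitive_of_WSL_eq_zero hdim θ₀ hW hS
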